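/- Fix the standard numbering of the partial computable functions $\varphi_e$ $(e\in\mathbb N)$, and identify bit strings with natural numbers through the length-lexicographic bijection. A *(prefix-free) machine* is a program $e$ such that the set of strings on which $\varphi_e$ halts is prefix-free; its halting probability is $\Omega_e=\sum_{\varphi_e(s)\downarrow}2^{-|s|}$. A machine $u$ is *universal* if for every machine $e$ there is a constant $c$ such that whenever $\varphi_e(s)=t$ there is $s'$ with $\varphi_u(s')=t$ and $|s'|\le|s|+c$. Let $\gamma_e\in[0,1]$ be the $e$-th c.e. real, i.e. the supremum of the rationals in $[0,1]$ listed by $\varphi_e$ (equivalently, the limit of the increasing computable sequence of the greatest rational listed so far; $0$ if none is listed); $(\gamma_e)_e$ is an effective enumeration of all c.e. reals in $[0,1]$, and $e$ is regarded as a representation of the real $\gamma_e$. Call an index $e$ *provably random* if Peano Arithmetic (PA), in the language $0,1,+,\cdot,<$, proves the arithmetical sentence "$\gamma_{e}\in(0,1)$" and proves the arithmetical sentence "$\gamma_{e}$ is random", in one of the two forms: (Chaitin) there are a universal machine $U$ and a constant $c$ such that for all $n\ge1$ every program $p$ with $U(p)=\gamma_e(n)$ has $|p|\ge n-c$, where $\gamma_e(n)$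 is the string of the first $n$ binary digits of $\gamma_e$; or (Solovay) $\gamma_e=2^{-c}\cdot\Omega_V+\gamma_k$ for some universal machine $V$, some $c\ge0$ and some $k$ with $\gamma_k>0$. Here the real $\gamma_e$ is presented to PA by the program $e$. **Theorem.** The set of provably random indices is computably enumerable: there is a primitive recursive enumeration $f$ (which is allowed to output nothing at some stages) whose outputs are exactly the provably random indices. There are computable functions $r$ that turn every machine $e$ into a representation $r(e)$ of its halting probability, i.e. $\gamma_{r(e)}=\Omega_e$ for every machine $e$; and for every such $r$ there is a universal machine $U_t$ (with program $t$) whose halting probability, as represented by $r(t)$, differs from all the $\gamma_{f(i)}$ as represented by $f(i)$: $r(t)\ne f(i)$ for all $i$. That is, based on $U_t$, PA cannot prove the randomness of $\Omega_{U_t}$. -/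

import Mathlib

namespace ProvRand

/-! ## First-order arithmetic: syntax

Terms and formulas of the language `0, 1, +, ·, <` with de Bruijn indices: `var i` refers to the
`i`-th innermost enclosing quantifier. -/

inductive Tm : Type
  | var (i : ℕ) : Tm
  | zero : Tm
  | one : Tm
  | add (t u : Tm) : Tm
  | mul (t u : Tm) : Tm

inductive Fml : Type
  | bot : Fml
  | eq (t u : Tm) : Fml
  | lt (t u : Tm) : Fml
  | imp (φ ψ : Fml) : Fml
  | all (φ : Fml) : Fml

instance : Zero Tm := ⟨Tm.zero⟩
instance : One Tm := ⟨Tm.one⟩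
instance : Add Tm := ⟨Tm.add⟩
instance : Mul Tm := ⟨Tm.mul⟩

/-- The closed term `(⋯((0 + 1) + 1) ⋯ + 1)` denoting `n`. -/
def num : ℕ → Tm
  | 0 => 0
  | n + 1 => num n + 1

/-- Raise by one all variables with index at least `k`. -/
def Tm.lift (k : ℕ) : Tm → Tm
  | var i => if i < k then var i else var (i + 1)
  | zero => zero
  | one => one
  | add t u => add (t.lift k) (u.lift k)
  | mul t u => mul (t.lift k) (u.lift k)

/-- Replace variable `k` by `s`, lowering by one the variables with larger index. -/
def Tm.subst (k : ℕ) (s : Tm) : Tm → Tm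
  | var i => if i < k then var i else if i = k then s else var (i - 1)
  | zero => zero
  | one => one
  | add t u => add (Tm.subst k s t) (Tm.subst k s u)
  | mul t u => mul (Tm.subst k s t) (Tm.subst k s u)

/-- The term `t`, read below `n` additional quantifiers. -/
def Tm.up (t : Tm) : ℕ → Tm
  | 0 => t
  | n + 1 => (t.up n).lift 0

namespace Fml

def lift (k : ℕ) : Fml → Fml
  | bot => bot
  | eq t u => eq (t.lift k) (u.lift k)
  | lt t u => lt (t.lift k) (u.lift k)
  | imp φ ψ => imp (φ.lift k) (ψ.lift k)
  | all φ => all (φ.lift (k + 1))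

/-- Capture-avoiding substitution of `s` for variable `k`. -/
def subst (k : ℕ) (s : Tm) : Fml → Fml
  | bot => bot
  | eq t u => eq (Tm.subst k s t) (Tm.subst k s u)
  | lt t u => lt (Tm.subst k s t) (Tm.subst k s u)
  | imp φ ψ => imp (φ.subst k s) (ψ.subst k s)
  | all φ => all (φ.subst (k + 1) (s.lift 0))

def neg (φ : Fml) : Fml := imp φ bot
def or (φ ψ : Fml) : Fml := imp (neg φ) ψ
def and (φ ψ : Fml) : Fml := neg (imp φ (neg ψ))
def iff (φ ψ : Fml) : Fml := and (imp φ ψ) (imp ψ φ)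
def ex (φ : Fml) : Fml := neg (all (neg φ))

/-- A block of `n` universal quantifiers; the outermost one binds `var (n - 1)`. -/
def alls : ℕ → Fml → Fml
  | 0, φ => φ
  | n + 1, φ => all (alls n φ)

/-- A block of `n` existential quantifiers; the outermost one binds `var (n - 1)`. -/
def exs : ℕ → Fml → Fml
  | 0, φ => φ
  | n + 1, φ => ex (exs n φ)

end Fml

open Fml

/-! ## Peano arithmetic and formal provability -/

/-- Derivability in classical first-order logic with equality (a Hilbert calculus) from the
universal closures of the formulas in `Ax`. -/
inductive Derivable (Ax : Fml → Prop) : Fml → Prop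
  | ax {φ : Fml} : Ax φ → Derivable Ax φ
  | k (φ ψ : Fml) : Derivable Ax (imp φ (imp ψ φ))
  | s (φ ψ χ : Fml) :
      Derivable Ax (imp (imp φ (imp ψ χ)) (imp (imp φ ψ) (imp φ χ)))
  | dne (φ : Fml) : Derivable Ax (imp (neg (neg φ)) φ)
  | inst (φ : Fml) (t : Tm) : Derivable Ax (imp (all φ) (φ.subst 0 t))
  | distrib (φ ψ : Fml) : Derivable Ax (imp (all (imp φ ψ)) (imp (all φ) (all ψ)))
  | vacuous (φ : Fml) : Derivable Ax (imp φ (all (φ.lift 0)))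
  | refl (t : Tm) : Derivable Ax (eq t t)
  | leibniz (φ : Fml) (t u : Tm) :
      Derivable Ax (imp (eq t u) (imp (φ.subst 0 t) (φ.subst 0 u)))
  | mp {φ ψ : Fml} : Derivable Ax (imp φ ψ) → Derivable Ax φ → Derivable Ax ψ
  | gen {φ : Fml} : Derivable Ax φ → Derivable Ax (all φ)

abbrev v (i : ℕ) : Tm := Tm.var i

/-- The axioms of Peano arithmetic: the theory of the non-negative parts of discretely ordered
rings, and induction for every formula `φ` in the variable `var 0` (with arbitrary further
variables as parameters). Free variables are understood as universally quantified. -/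
inductive PAAxiom : Fml → Prop
  | add_assoc : PAAxiom (eq ((v 0 + v 1) + v 2) (v 0 + (v 1 + v 2)))
  | add_comm : PAAxiom (eq (v 0 + v 1) (v 1 + v 0))
  | mul_assoc : PAAxiom (eq ((v 0 * v 1) * v 2) (v 0 * (v 1 * v 2)))
  | mul_comm : PAAxiom (eq (v 0 * v 1) (v 1 * v 0))
  | distrib : PAAxiom (eq (v 0 * (v 1 + v 2)) (v 0 * v 1 + v 0 * v 2))
  | zero : PAAxiom (and (eq (v 0 + 0) (v 0)) (eq (v 0 * 0) 0))
  | mul_one : PAAxiom (eq (v 0 * 1) (v 0))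
  | lt_trans : PAAxiom (imp (and (lt (v 0) (v 1)) (lt (v 1) (v 2))) (lt (v 0) (v 2)))
  | lt_irrefl : PAAxiom (neg (lt (v 0) (v 0)))
  | trichotomy : PAAxiom (or (lt (v 0) (v 1)) (or (eq (v 0) (v 1)) (lt (v 1) (v 0))))
  | add_lt : PAAxiom (imp (lt (v 0) (v 1)) (lt (v 0 + v 2) (v 1 + v 2)))
  | mul_lt :
      PAAxiom (imp (and (lt 0 (v 2)) (lt (v 0) (v 1))) (lt (v 0 * v 2) (v 1 * v 2)))
  | sub : PAAxiom (imp (lt (v 0) (v 1)) (ex (eq (v 1 + v 0) (v 2))))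
  | discrete : PAAxiom (and (lt 0 1) (imp (lt 0 (v 0)) (or (lt 1 (v 0)) (eq 1 (v 0)))))
  | nonneg : PAAxiom (or (lt 0 (v 0)) (eq 0 (v 0)))
  | induction (φ : Fml) :
      PAAxiom (imp (φ.subst 0 0)
        (imp (all (imp φ ((φ.lift 1).subst 0 (v 0 + 1)))) (all φ)))

/-- `PA ⊢ φ`. -/
def PAProves (φ : Fml) : Prop := Derivable PAAxiom φ

/-! ## Programs, machines, halting probabilities, c.e. reals -/

/-- The partial computable function with program number `e`. -/
def prog (e : ℕ) : ℕ →. ℕ := (Denumerable.ofNat Nat.Partrec.Code e).eval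

/-- The canonical (length-lexicographic) bijection from bit strings to natural numbers. -/
def strNum (s : List Bool) : ℕ := s.foldl (fun n b => 2 * n + 1 + b.toNat) 0

/-- Program `e`, acting on bit strings, outputs `t` on input `s`. -/
def Outputs (e : ℕ) (s t : List Bool) : Prop := strNum t ∈ prog e (strNum s)

/-- Program `e` halts on the bit string `s`. -/
def Halts (e : ℕ) (s : List Bool) : Prop := ∃ t, Outputs e s t

/-- Program `e` is a prefix-free machine. -/
def IsMachine (e : ℕ) : Prop := ∀ s s', Halts e s → Halts e s' → s <+: s' → s = s'

/-- Program `u` is a universal prefix-free machine. -/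
def IsUniversal (u : ℕ) : Prop :=
  IsMachine u ∧ ∀ e, IsMachine e → ∃ c : ℕ, ∀ s t, Outputs e s t →
    ∃ s', Outputs u s' t ∧ s'.length ≤ s.length + c

/-- The halting probability of the machine `e`. -/
noncomputable def Omega (e : ℕ) : ℝ := ∑' s : {s // Halts e s}, (1 / 2 : ℝ) ^ s.1.length

/-- Program `e` lists the rational `a / (b + 1)` of the unit interval. -/
def Lists (e a b : ℕ) : Prop := a ≤ b + 1 ∧ ∃ n, Nat.pair a b ∈ prog e n

/-- The `e`-th c.e. real of the unit interval: the supremum of the rationals of the unit interval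
that program `e` lists (`0` if there are none), i.e. the limit of the increasing sequence of the
greatest rational listed so far. -/
noncomputable def ceReal (e : ℕ) : ℝ := sSup {x : ℝ | ∃ a b, Lists e a b ∧ x = a / (b + 1)}

/-! ## The same notions as formulas of arithmetic

The arguments of each of the following formulas are terms; numbers stand for bit strings through
`strNum` and for programs through the numbering of `Nat.Partrec.Code`. -/

section Formulas

local infix:50 " ≐ " => Fml.eq
local infix:50 " ≺ " => Fml.lt
local prefix:max "∼" => Fml.neg
local infixr:35 " ⋏ " => Fml.and
local infixr:30 " ⋎ " => Fml.or
local infixr:25 " ⇒ " => Fml.imp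
local infixr:20 " ⇔ " => Fml.iff

/-- `t ≤ u` -/
def leF (t u : Tm) : Fml := ∼(u ≺ t)

/-- `c = Nat.pair a b` -/
def pairF (a b c : Tm) : Fml :=
  (a ≺ b ⋏ c ≐ b * b + a) ⋎ (leF b a ⋏ c ≐ a * a + a + b)

/-- `z` is the `i`-th entry of the sequence coded by `s` (Gödel's β-function). -/
def betaF (s i z : Tm) : Fml :=
  exs 3 (pairF (v 2) (v 1) (s.up 3) ⋏
    v 2 ≐ v 0 * ((i.up 3 + 1) * v 1 + 1) + z.up 3 ⋏
    z.up 3 ≺ (i.up 3 + 1) * v 1 + 1)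

/-- `y = 2 ^ k` -/
def powF (k y : Tm) : Fml :=
  ex (betaF (v 0) 0 1 ⋏ betaF (v 0) (k.up 1) (y.up 1) ⋏
    all (v 0 ≺ k.up 2 ⇒
      ex (betaF (v 2) (v 1) (v 0) ⋏ betaF (v 2) (v 1 + 1) (v 0 + v 0))))

/-- The triple `(c, x, y)` is the `j`-th entry of the sequence `s`. -/
def entryF (s j c x y : Tm) : Fml :=
  exs 2 (pairF (x.up 2) (y.up 2) (v 1) ⋏ pairF (c.up 2) (v 1) (v 0) ⋏
    betaF (s.up 2) (j.up 2) (v 0))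

/-- The triple `(c, x, y)` occurs in the sequence `s` before position `k`. -/
def beforeF (s k c x y : Tm) : Fml :=
  ex (v 0 ≺ k.up 1 ⋏ entryF (s.up 1) (v 0) (c.up 1) (x.up 1) (y.up 1))

/-- "Program `c` on input `x` outputs `y`" follows from one rule of computation applied to triples
that occur in `s` before position `k`. -/
def stepF (s k c x y : Tm) : Fml :=
  (c ≐ 0 ⋏ y ≐ 0) ⋎
  (c ≐ 1 ⋏ y ≐ x + 1) ⋎
  (c ≐ num 2 ⋏ ex (pairF (y.up 1) (v 0) (x.up 1))) ⋎
  (c ≐ num 3 ⋏ ex (pairF (v 0) (y.up 1) (x.up 1))) ⋎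
  -- pairing of `f = v 4`, `g = v 3`, with values `v 1`, `v 0`
  exs 5 (pairF (v 4) (v 3) (v 2) ⋏ c.up 5 ≐ num 4 * v 2 + num 4 ⋏
    pairF (v 1) (v 0) (y.up 5) ⋏
    beforeF (s.up 5) (k.up 5) (v 4) (x.up 5) (v 1) ⋏
    beforeF (s.up 5) (k.up 5) (v 3) (x.up 5) (v 0)) ⋎
  -- composition of `f = v 3` after `g = v 2`
  exs 4 (pairF (v 3) (v 2) (v 1) ⋏ c.up 4 ≐ num 4 * v 1 + num 6 ⋏
    beforeF (s.up 4) (k.up 4) (v 2) (x.up 4) (v 0) ⋏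
    beforeF (s.up 4) (k.up 4) (v 3) (v 0) (y.up 4)) ⋎
  -- primitive recursion from `f = v 3`, `g = v 2`, at `x = (a, 0)` with `a = v 0`
  exs 4 (pairF (v 3) (v 2) (v 1) ⋏ c.up 4 ≐ num 4 * v 1 + num 5 ⋏
    pairF (v 0) 0 (x.up 4) ⋏
    beforeF (s.up 4) (k.up 4) (v 3) (v 0) (y.up 4)) ⋎
  -- primitive recursion from `f = v 8`, `g = v 7`, at `x = (a, m + 1)` with `a = v 5`, `m = v 4`,
  -- where `v 3` is the value at `(a, m) = v 2` and `v 0 = (a, (m, v 3))`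
  exs 9 (pairF (v 8) (v 7) (v 6) ⋏ c.up 9 ≐ num 4 * v 6 + num 5 ⋏
    pairF (v 5) (v 4 + 1) (x.up 9) ⋏ pairF (v 5) (v 4) (v 2) ⋏
    beforeF (s.up 9) (k.up 9) (c.up 9) (v 2) (v 3) ⋏
    pairF (v 4) (v 3) (v 1) ⋏ pairF (v 5) (v 1) (v 0) ⋏
    beforeF (s.up 9) (k.up 9) (v 7) (v 0) (y.up 9)) ⋎
  -- unbounded search for a zero of `f = v 1`: found at `x = (v 0, y)`
  exs 2 (c.up 2 ≐ num 4 * v 1 + num 7 ⋏ pairF (v 0) (y.up 2) (x.up 2) ⋏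
    beforeF (s.up 2) (k.up 2) (v 1) (x.up 2) 0) ⋎
  -- unbounded search for a zero of `f = v 4`: not found at `x = (v 3, v 2)`, hence continued at
  -- `v 1 = (v 3, v 2 + 1)`
  exs 5 (c.up 5 ≐ num 4 * v 4 + num 7 ⋏ pairF (v 3) (v 2) (x.up 5) ⋏
    beforeF (s.up 5) (k.up 5) (v 4) (x.up 5) (v 0 + 1) ⋏
    pairF (v 3) (v 2 + 1) (v 1) ⋏
    beforeF (s.up 5) (k.up 5) (c.up 5) (v 1) (y.up 5))

/-- Program `e` outputs `y` on input `x`: some finite sequence of triples, each obtained by a rule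
of computation from earlier ones, contains `(e, x, y)`. -/
def progF (e x y : Tm) : Fml :=
  exs 2 (beforeF (v 1) (v 0) (e.up 2) (x.up 2) (y.up 2) ⋏
    all (v 0 ≺ v 1 ⇒
      exs 3 (entryF (v 5) (v 3) (v 2) (v 1) (v 0) ⋏
        stepF (v 5) (v 3) (v 2) (v 1) (v 0))))

/-- Program `e` halts on `x`. -/
def haltsF (e x : Tm) : Fml := ex (progF (e.up 1) (x.up 1) (v 0))

/-- The string `s` has length `l`, and `p = 2 ^ l`. -/
def lenPowF (s l p : Tm) : Fml := powF l p ⋏ leF p (s + 1) ⋏ s + 1 ≺ p + p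

/-- The string `s` has length `l`. -/
def lenF (s l : Tm) : Fml := ex (lenPowF (s.up 1) (l.up 1) (v 0))

/-- The string `s` is a prefix of the string `t`. -/
def prefixF (s t : Tm) : Fml :=
  exs 3 (powF (v 2) (v 1) ⋏ t.up 3 + 1 ≐ (s.up 3 + 1) * v 1 + v 0 ⋏ v 0 ≺ v 1)

/-- Program `e` is a prefix-free machine. -/
def machineF (e : Tm) : Fml :=
  alls 2 (haltsF (e.up 2) (v 1) ⇒ haltsF (e.up 2) (v 0) ⇒ prefixF (v 1) (v 0) ⇒ v 1 ≐ v 0)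

/-- Program `u` is a universal prefix-free machine. -/
def universalF (u : Tm) : Fml :=
  machineF u ⋏
  all (machineF (v 0) ⇒
    -- `v 3` is the other machine, `v 2` the constant, `v 1` and `v 0` its input and output
    ex (alls 2 (progF (v 3) (v 1) (v 0) ⇒
      -- `v 2` is the new input, of length `v 0`; the old one has length `v 1`
      exs 3 (progF (u.up 7) (v 2) (v 3) ⋏ lenF (v 4) (v 1) ⋏ lenF (v 2) (v 0) ⋏
        leF (v 0) (v 1 + v 5)))))

/-- Program `e` lists the rational `a / (b + 1)` of the unit interval. -/
def listsF (e a b : Tm) : Fml :=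
  leF a (b + 1) ⋏
  exs 2 (pairF (a.up 2) (b.up 2) (v 0) ⋏ progF (e.up 2) (v 1) (v 0))

/-- The `e`-th c.e. real exceeds `p / q` (for `q > 0`). -/
def aboveF (e p q : Tm) : Fml :=
  exs 2 (listsF (e.up 2) (v 1) (v 0) ⋏ p.up 2 * (v 0 + 1) ≺ v 1 * q.up 2)

/-- The `e`-th c.e. real is less than `p / q` (for `q > 0`): it does not exceed some rational
below `p / q`. -/
def belowF (e p q : Tm) : Fml :=
  exs 2 (0 ≺ v 0 ⋏ v 1 * q.up 2 ≺ p.up 2 * v 0 ⋏ ∼(aboveF (e.up 2) (v 1) (v 0)))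

/-- The `e`-th c.e. real lies in the open interval `(0, 1)`. -/
def unitF (e : Tm) : Fml := aboveF e 0 1 ⋏ belowF e 1 1

/-- The string `s` consists of the first `n` binary digits of the `e`-th c.e. real `γ`: with
`p = 2 ^ n = v 1` and `s + 1 = p + m`, `m = v 0 < p`, one has `m / p ≤ γ < (m + 1) / p`. -/
def digitsF (e n s : Tm) : Fml :=
  exs 2 (powF (n.up 2) (v 1) ⋏ s.up 2 + 1 ≐ v 1 + v 0 ⋏ v 0 ≺ v 1 ⋏
    ∼(belowF (e.up 2) (v 0) (v 1)) ⋏ belowF (e.up 2) (v 0 + 1) (v 1))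

/-- The `e`-th c.e. real `γ` is Chaitin-random: there are a universal machine `U = v 1` and a
constant `c = v 0` such that `H_U(γ(n)) ≥ n - c` for all `n ≥ 1`. -/
def chaitinF (e : Tm) : Fml :=
  exs 2 (universalF (v 1) ⋏
    all (0 ≺ v 0 ⇒
      -- `n = v 1`, `γ(n) = v 0`
      ex (digitsF (e.up 4) (v 1) (v 0) ⋏
        all (progF (v 4) (v 0) (v 1) ⇒
          ex (lenF (v 1) (v 0) ⋏ leF (v 3) (v 0 + v 4))))))

/-- The sum of `2 ^ (-|x|)` over some finite set of strings `x` on which program `e` halts equals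
`p / 2 ^ n`. The strings are the first `L = v 1` entries of the strictly increasing sequence
`v 3`, the numerators of the partial sums form the sequence `v 2`, and `v 0 = 2 ^ n`. -/
def partialSumF (e p n : Tm) : Fml :=
  exs 4 (powF (n.up 4) (v 0) ⋏ betaF (v 2) 0 0 ⋏ betaF (v 2) (v 1) (p.up 4) ⋏
    all (v 0 ≺ v 2 ⇒
      -- at stage `j = v 6`: string `v 5`, next string `v 4`, partial sum `v 3`, length `v 2`,
      -- `v 1 = 2 ^ length`, summand `v 0`
      exs 6 (betaF (v 10) (v 6) (v 5) ⋏ betaF (v 10) (v 6 + 1) (v 4) ⋏ v 5 ≺ v 4 ⋏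
        haltsF (e.up 11) (v 5) ⋏ lenPowF (v 5) (v 2) (v 1) ⋏ v 1 * v 0 ≐ v 7 ⋏
        betaF (v 9) (v 6) (v 3) ⋏ betaF (v 9) (v 6 + 1) (v 3 + v 0))))

/-- `γ_e = 2 ^ (-c) * Ω_u + γ_k`, where `γ_k > 0`: a rational `p / q` is exceeded by `γ_e` if and
only if it is exceeded by `2 ^ (-c) * (P / 2 ^ N) + a / (b + 1)` for some partial sum `P / 2 ^ N`
of `Ω_u` and some rational `a / (b + 1)` listed by `k`. -/
def solovaySumF (e c u k : Tm) : Fml :=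
  alls 2 (0 ≺ v 0 ⇒
    (aboveF (e.up 2) (v 1) (v 0) ⇔
      -- `p = v 6`, `q = v 5`, `P = v 4`, `N = v 3`, `a = v 2`, `b = v 1`, `2 ^ (N + c) = v 0`
      exs 5 (partialSumF (u.up 7) (v 4) (v 3) ⋏ listsF (k.up 7) (v 2) (v 1) ⋏
        powF (v 3 + c.up 7) (v 0) ⋏
        v 6 * (v 0 * (v 1 + 1)) ≺ v 5 * (v 4 * (v 1 + 1) + v 2 * v 0))))

/-- The `e`-th c.e. real has the form `2 ^ (-c) * Ω_V + γ` with `V` a universal machine and `γ` a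
positive c.e. real. -/
def solovayF (e : Tm) : Fml :=
  exs 3 (universalF (v 1) ⋏ aboveF (v 0) 0 1 ⋏ solovaySumF (e.up 3) (v 2) (v 1) (v 0))

end Formulas

/-- PA proves, of the `e`-th c.e. real as given by program `e`, that it lies in `(0, 1)` and that
it is random: either that it is Chaitin-random or that it has the form `2 ^ (-c) * Ω_V + γ` above.
(The existential quantifiers over `V`, `c`, `γ` are inside the sentence, so a proof for particular
`V`, `c`, `γ` is a special case.) -/
def ProvablyRandom (e : ℕ) : Prop :=
  PAProves ((unitF (v 0)).subst 0 (num e)) ∧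
    (PAProves ((chaitinF (v 0)).subst 0 (num e)) ∨ PAProves ((solovayF (v 0)).subst 0 (num e)))

/-- `r` effectively turns every prefix-free machine into a representation, as a c.e. real, of its
halting probability. -/
def RepresentsOmega (r : ℕ → ℕ) : Prop :=
  Computable r ∧ ∀ e, IsMachine e → ceReal (r e) = Omega e

end ProvRand

/-!
Every theorem of Peano Arithmetic holds in the standard model. A halting computation makes its
arithmetization true there, so an index of the real `1`, which lists rationals arbitrarily close to
`1`, makes the sentence `γ < 1` false: no index of `1` is provably random.

Terms, formulas, axioms, derivability and the construction of the sentences that define provable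
randomness are generated by finitely many Horn clauses over coded trees, and the least model of
such clauses is enumerated by a primitive recursive `f` that checks coded derivation trees.

By the recursion theorem there is a program `t` that simulates a universal prefix-free machine
until `f` lists `r t`; from that moment it halts, besides the finitely many strings already found,
exactly on the strings of one fixed length that complete them to a maximal prefix-free set. If `f`
ever listed `r t`, the halting probability of `t` would be `1`, so `r t` would be an index of the
real `1` that is provably random. Hence `r t` is never listed, and `t` is universal.
-/

namespace ProvRand

open Fml

/-! ## The standard model -/

/-- The assignment `ρ` with the value `a` inserted at position `k`: the semantic counterpart of a
substitution for variable `k`, and for `k = 0` of passing below a quantifier. -/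
def insertAt (k a : ℕ) (ρ : ℕ → ℕ) (i : ℕ) : ℕ :=
  if i < k then ρ i else if i = k then a else ρ (i - 1)

@[simp] theorem insertAt_zero_zero (a : ℕ) (ρ : ℕ → ℕ) : insertAt 0 a ρ 0 = a := by
  simp [insertAt]

@[simp] theorem insertAt_zero_succ (a i : ℕ) (ρ : ℕ → ℕ) : insertAt 0 a ρ (i + 1) = ρ i := by
  simp [insertAt]

theorem insertAt_succ (k a b : ℕ) (ρ : ℕ → ℕ) :
    insertAt (k + 1) b (insertAt 0 a ρ) = insertAt 0 a (insertAt k b ρ) := by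
  funext i
  rcases i with - | i
  · simp [insertAt]
  · rw [insertAt_zero_succ]
    rcases lt_trichotomy i k with hlt | rfl | hgt
    · simp [insertAt, hlt]
    · simp [insertAt]
    · simp [insertAt, hgt.not_gt, hgt.ne', (Nat.zero_le k).trans_lt hgt |>.ne']

/-- The value of a term in the standard model. -/
def Tm.val (ρ : ℕ → ℕ) : Tm → ℕ
  | var i => ρ i
  | zero => 0
  | one => 1
  | add t u => t.val ρ + u.val ρ
  | mul t u => t.val ρ * u.val ρ

/-- Truth in the standard model. -/
def Fml.Sat : (ℕ → ℕ) → Fml → Prop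
  | _, bot => False
  | ρ, eq t u => t.val ρ = u.val ρ
  | ρ, lt t u => t.val ρ < u.val ρ
  | ρ, imp φ ψ => φ.Sat ρ → ψ.Sat ρ
  | ρ, all φ => ∀ a, φ.Sat (insertAt 0 a ρ)

section Semantics

variable (ρ : ℕ → ℕ)

@[simp] theorem val_var (i : ℕ) : (Tm.var i).val ρ = ρ i := rfl
@[simp] theorem val_zero : (0 : Tm).val ρ = 0 := rfl
@[simp] theorem val_one : (1 : Tm).val ρ = 1 := rfl
@[simp] theorem val_add (t u : Tm) : (t + u).val ρ = t.val ρ + u.val ρ := rfl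
@[simp] theorem val_mul (t u : Tm) : (t * u).val ρ = t.val ρ * u.val ρ := rfl

@[simp] theorem val_num (n : ℕ) : (num n).val ρ = n := by
  induction n with
  | zero => rfl
  | succ n ih => simp [num, ih]

theorem val_lift (k a : ℕ) (t : Tm) : (t.lift k).val (insertAt k a ρ) = t.val ρ := by
  induction t with
  | var i =>
    by_cases h : i < k
    · simp [Tm.lift, h, insertAt]
    · have h₁ : ¬ i + 1 < k := by omega
      have h₂ : i + 1 ≠ k := by omega
      simp [Tm.lift, h, insertAt, h₁, h₂]
  | zero | one => rfl
  | add t u iht ihu | mul t u iht ihu => simp [Tm.lift, Tm.val, iht, ihu]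

theorem val_subst (k : ℕ) (s t : Tm) :
    (Tm.subst k s t).val ρ = t.val (insertAt k (s.val ρ) ρ) := by
  induction t with
  | var i => simp only [Tm.subst, insertAt, val_var]; split_ifs <;> rfl
  | zero | one => rfl
  | add t u iht ihu | mul t u iht ihu => simp [Tm.subst, Tm.val, iht, ihu]

@[simp] theorem val_up_zero (t : Tm) : (t.up 0).val ρ = t.val ρ := rfl

@[simp] theorem val_up_succ (t : Tm) (n a : ℕ) :
    (t.up (n + 1)).val (insertAt 0 a ρ) = (t.up n).val ρ := val_lift ρ 0 a _

@[simp] theorem sat_eq (t u : Tm) : Sat ρ (eq t u) ↔ t.val ρ = u.val ρ := Iff.rfl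
@[simp] theorem sat_lt (t u : Tm) : Sat ρ (lt t u) ↔ t.val ρ < u.val ρ := Iff.rfl
@[simp] theorem sat_imp (φ ψ : Fml) : Sat ρ (imp φ ψ) ↔ (φ.Sat ρ → ψ.Sat ρ) := Iff.rfl
@[simp] theorem sat_all (φ : Fml) : Sat ρ (all φ) ↔ ∀ a, φ.Sat (insertAt 0 a ρ) := Iff.rfl
@[simp] theorem sat_neg (φ : Fml) : Sat ρ (neg φ) ↔ ¬ φ.Sat ρ := Iff.rfl
@[simp] theorem sat_or (φ ψ : Fml) : Sat ρ (or φ ψ) ↔ φ.Sat ρ ∨ ψ.Sat ρ := by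
  simp [Fml.or, or_iff_not_imp_left]
@[simp] theorem sat_and (φ ψ : Fml) : Sat ρ (and φ ψ) ↔ φ.Sat ρ ∧ ψ.Sat ρ := by
  simp [Fml.and]
@[simp] theorem sat_ex (φ : Fml) : Sat ρ (ex φ) ↔ ∃ a, φ.Sat (insertAt 0 a ρ) := by
  simp [Fml.ex]
@[simp] theorem sat_exs_zero (φ : Fml) : Sat ρ (exs 0 φ) ↔ φ.Sat ρ := Iff.rfl
@[simp] theorem sat_exs_succ (n : ℕ) (φ : Fml) :
    Sat ρ (exs (n + 1) φ) ↔ ∃ a, (exs n φ).Sat (insertAt 0 a ρ) := sat_ex ρ _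

end Semantics

theorem sat_lift (φ : Fml) (k a : ℕ) (ρ : ℕ → ℕ) :
    (φ.lift k).Sat (insertAt k a ρ) ↔ φ.Sat ρ := by
  induction φ generalizing k ρ with
  | bot => rfl
  | eq t u | lt t u => simp [Fml.lift, val_lift]
  | imp φ ψ ihφ ihψ => simp [Fml.lift, ihφ, ihψ]
  | all φ ih => simp [Fml.lift, ← insertAt_succ, ih]

theorem sat_subst (φ : Fml) (k : ℕ) (s : Tm) (ρ : ℕ → ℕ) :
    (φ.subst k s).Sat ρ ↔ φ.Sat (insertAt k (s.val ρ) ρ) := by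
  induction φ generalizing k s ρ with
  | bot => rfl
  | eq t u | lt t u => simp [Fml.subst, val_subst]
  | imp φ ψ ihφ ihψ => simp [Fml.subst, ihφ, ihψ]
  | all φ ih => simp [Fml.subst, ih, val_lift, insertAt_succ]

theorem Derivable.sat {Ax : Fml → Prop} (hAx : ∀ φ, Ax φ → ∀ ρ, φ.Sat ρ) {φ : Fml}
    (h : Derivable Ax φ) (ρ : ℕ → ℕ) : φ.Sat ρ := by
  induction h generalizing ρ with
  | ax h => exact hAx _ h ρ
  | k φ ψ => exact fun h _ => h
  | s φ ψ χ => exact fun h h' h'' => h h'' (h' h'')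
  | dne φ => exact fun h => not_not.1 h
  | inst φ t => exact fun h => (sat_subst ..).2 (h _)
  | distrib φ ψ => exact fun h h' a => h a (h' a)
  | vacuous φ => exact fun h a => (sat_lift ..).2 h
  | refl t => rfl
  | leibniz φ t u =>
    intro h h'
    rw [sat_eq] at h
    rw [sat_subst] at h' ⊢
    rwa [← h]
  | mp _ _ ih ih' => exact ih ρ (ih' ρ)
  | gen _ ih => exact fun a => ih _

theorem sat_of_paAxiom {φ : Fml} (h : PAAxiom φ) (ρ : ℕ → ℕ) : φ.Sat ρ := by
  cases h with
  | induction φ =>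
    simp only [sat_imp, sat_all, sat_subst, val_zero, val_add, val_one, val_var,
      insertAt_zero_zero]
    intro h0 hs n
    induction n with
    | zero => exact h0
    | succ n ih =>
      have := hs n ih
      rwa [← insertAt_succ, sat_lift] at this
  | lt_trans => simpa using fun h h' => lt_trans h h'
  | trichotomy => simpa using lt_trichotomy _ _
  | mul_lt => simpa using fun h h' => Nat.mul_lt_mul_of_pos_right h' h
  | sub => simpa using fun h => ⟨ρ 1 - ρ 0, by omega⟩
  | discrete => simp only [sat_and, sat_imp, sat_or, sat_lt, sat_eq, val_zero, val_one]; omega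
  | nonneg => simp only [sat_or, sat_lt, sat_eq, val_zero]; omega
  | _ => simp [add_assoc, add_comm, mul_assoc, mul_comm, mul_add]

theorem PAProves.sat {φ : Fml} (h : PAProves φ) (ρ : ℕ → ℕ) : φ.Sat ρ :=
  Derivable.sat (fun _ => sat_of_paAxiom) h ρ

/-! ## Arithmetized computations -/

@[simp] theorem sat_leF (ρ : ℕ → ℕ) (t u : Tm) : Sat ρ (leF t u) ↔ t.val ρ ≤ u.val ρ := by
  simp [leF]

@[simp] theorem sat_pairF (ρ : ℕ → ℕ) (a b c : Tm) :
    Sat ρ (pairF a b c) ↔ c.val ρ = Nat.pair (a.val ρ) (b.val ρ) := by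
  by_cases h : a.val ρ < b.val ρ
  · simp [pairF, Nat.pair, h]
  · simp [pairF, Nat.pair, h, not_lt.1 h]

theorem beta_eq_iff (s i z : ℕ) :
    Nat.beta s i = z ↔ ∃ a b q, s = Nat.pair a b ∧ a = q * ((i + 1) * b + 1) + z ∧
      z < (i + 1) * b + 1 := by
  constructor
  · rintro rfl
    refine ⟨s.unpair.1, s.unpair.2, s.unpair.1 / ((i + 1) * s.unpair.2 + 1), by simp, ?_,
      Nat.mod_lt _ (Nat.succ_pos _)⟩
    rw [Nat.beta, Nat.div_add_mod']
  · rintro ⟨a, b, q, rfl, rfl, h⟩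
    simp [Nat.beta, Nat.mod_eq_of_lt h]

@[simp] theorem sat_betaF (ρ : ℕ → ℕ) (s i z : Tm) :
    Sat ρ (betaF s i z) ↔ Nat.beta (s.val ρ) (i.val ρ) = z.val ρ := by
  simp [betaF, beta_eq_iff]

@[simp] theorem sat_entryF (ρ : ℕ → ℕ) (s j c x y : Tm) :
    Sat ρ (entryF s j c x y) ↔
      Nat.beta (s.val ρ) (j.val ρ) = Nat.pair (c.val ρ) (Nat.pair (x.val ρ) (y.val ρ)) := by
  simp [entryF]

@[simp] theorem sat_beforeF (ρ : ℕ → ℕ) (s k c x y : Tm) :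
    Sat ρ (beforeF s k c x y) ↔ ∃ j < k.val ρ,
      Nat.beta (s.val ρ) j = Nat.pair (c.val ρ) (Nat.pair (x.val ρ) (y.val ρ)) := by
  simp [beforeF]

/-- The triple (program, input, output) follows from triples in `P` by one rule of computation: the
relation that `stepF` arithmetizes. -/
inductive Step (P : ℕ → ℕ → ℕ → Prop) : ℕ → ℕ → ℕ → Prop
  | zero (x : ℕ) : Step P 0 x 0
  | succ (x : ℕ) : Step P 1 x (x + 1)
  | left (a b : ℕ) : Step P 2 (Nat.pair a b) a
  | right (a b : ℕ) : Step P 3 (Nat.pair a b) b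
  | pair {f g x a b : ℕ} : P f x a → P g x b → Step P (4 * Nat.pair f g + 4) x (Nat.pair a b)
  | comp {f g x z y : ℕ} : P g x z → P f z y → Step P (4 * Nat.pair f g + 6) x y
  | precZero {f g a y : ℕ} : P f a y → Step P (4 * Nat.pair f g + 5) (Nat.pair a 0) y
  | precSucc {f g a m i y : ℕ} : P (4 * Nat.pair f g + 5) (Nat.pair a m) i →
      P g (Nat.pair a (Nat.pair m i)) y → Step P (4 * Nat.pair f g + 5) (Nat.pair a (m + 1)) y
  | found {f a y : ℕ} : P f (Nat.pair a y) 0 → Step P (4 * f + 7) (Nat.pair a y) y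
  | next {f a m n y : ℕ} : P f (Nat.pair a m) (n + 1) →
      P (4 * f + 7) (Nat.pair a (m + 1)) y → Step P (4 * f + 7) (Nat.pair a m) y

theorem Step.mono {P Q : ℕ → ℕ → ℕ → Prop} (h : ∀ c x y, P c x y → Q c x y) {c x y : ℕ}
    (hs : Step P c x y) : Step Q c x y := by
  cases hs with
  | zero => exact .zero _
  | succ => exact .succ _
  | left => exact .left _ _
  | right => exact .right _ _
  | pair h₁ h₂ => exact .pair (h _ _ _ h₁) (h _ _ _ h₂)
  | comp h₁ h₂ => exact .comp (h _ _ _ h₁) (h _ _ _ h₂)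
  | precZero h₁ => exact .precZero (h _ _ _ h₁)
  | precSucc h₁ h₂ => exact .precSucc (h _ _ _ h₁) (h _ _ _ h₂)
  | found h₁ => exact .found (h _ _ _ h₁)
  | next h₁ h₂ => exact .next (h _ _ _ h₁) (h _ _ _ h₂)

theorem sat_stepF_of_step {ρ : ℕ → ℕ} {s k c x y : Tm}
    (h : Step (fun c x y => ∃ j < k.val ρ, Nat.beta (s.val ρ) j = Nat.pair c (Nat.pair x y))
      (c.val ρ) (x.val ρ) (y.val ρ)) : Sat ρ (stepF s k c x y) := by
  generalize hc : c.val ρ = c' at h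
  generalize hx : x.val ρ = x' at h
  generalize hy : y.val ρ = y' at h
  simp only [stepF, sat_or, sat_exs_succ, sat_exs_zero]
  cases h with
  | zero => exact .inl (by simp [hc, hy])
  | succ => exact .inr <| .inl (by simp [hc, hx, hy])
  | left a b => exact .inr <| .inr <| .inl (by simp [hc, hx, hy])
  | right a b => exact .inr <| .inr <| .inr <| .inl (by simp [hc, hx, hy])
  | @pair f g _ a b h₁ h₂ =>
    iterate 4 right
    exact .inl ⟨f, g, Nat.pair f g, a, b, by simpa [hc, hx, hy] using ⟨h₁, h₂⟩⟩
  | @comp f g _ z _ h₁ h₂ =>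
    iterate 5 right
    exact .inl ⟨f, g, Nat.pair f g, z, by simpa [hc, hx, hy] using ⟨h₁, h₂⟩⟩
  | @precZero f g a _ h₁ =>
    iterate 6 right
    exact .inl ⟨f, g, Nat.pair f g, a, by simpa [hc, hx, hy] using h₁⟩
  | @precSucc f g a m i _ h₁ h₂ =>
    iterate 7 right
    exact .inl ⟨f, g, Nat.pair f g, a, m, i, Nat.pair a m, Nat.pair m i,
      Nat.pair a (Nat.pair m i), by simpa [hc, hx, hy] using ⟨h₁, h₂⟩⟩
  | @found f a _ h₁ =>
    iterate 8 right
    exact .inl ⟨f, a, by simpa [hc, hx, hy] using h₁⟩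
  | @next f a m n _ h₁ h₂ =>
    iterate 9 right
    exact ⟨f, a, m, Nat.pair a (m + 1), n, by simpa [hc, hx, hy] using ⟨h₁, h₂⟩⟩

/-- A sequence of coded triples, each obtained by a rule of computation from earlier ones. -/
inductive IsComputation : List ℕ → Prop
  | nil : IsComputation []
  | concat {L : List ℕ} {c x y : ℕ} : IsComputation L →
      Step (fun c x y => Nat.pair c (Nat.pair x y) ∈ L) c x y →
      IsComputation (L ++ [Nat.pair c (Nat.pair x y)])

theorem IsComputation.append {L M : List ℕ} (hL : IsComputation L) (hM : IsComputation M) :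
    IsComputation (L ++ M) := by
  induction hM with
  | nil => simpa using hL
  | concat _ hstep ih =>
    rw [← List.append_assoc]
    exact ih.concat (hstep.mono fun _ _ _ => List.mem_append_right _)

theorem IsComputation.exists_step {L : List ℕ} (hL : IsComputation L) {k : ℕ}
    (hk : k < L.length) : ∃ c x y, L[k] = Nat.pair c (Nat.pair x y) ∧
      Step (fun c x y => ∃ j, ∃ h : j < k, L[j] = Nat.pair c (Nat.pair x y)) c x y := by
  induction hL with
  | nil => simp at hk
  | @concat L c x y _ hstep ih =>
    rcases Nat.lt_or_ge k L.length with h | h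
    · obtain ⟨c, x, y, hLk, hstep⟩ := ih h
      refine ⟨c, x, y, by rw [List.getElem_append_left h, hLk], hstep.mono ?_⟩
      rintro c x y ⟨j, hj, hLj⟩
      exact ⟨j, hj, by rw [List.getElem_append_left (hj.trans h), hLj]⟩
    · obtain rfl : k = L.length := by simp at hk; omega
      refine ⟨c, x, y, by simp, hstep.mono fun c x y hmem => ?_⟩
      obtain ⟨j, hj, hLj⟩ := List.getElem_of_mem hmem
      exact ⟨j, hj, by rw [List.getElem_append_left hj, hLj]⟩

/-- Some computation contains the triple `(c, x, y)`. -/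
def Computes (c x y : ℕ) : Prop := ∃ L, IsComputation L ∧ Nat.pair c (Nat.pair x y) ∈ L

theorem Computes.exists_common {c x y c' x' y' : ℕ} (h : Computes c x y)
    (h' : Computes c' x' y') : ∃ L, IsComputation L ∧
      Nat.pair c (Nat.pair x y) ∈ L ∧ Nat.pair c' (Nat.pair x' y') ∈ L := by
  obtain ⟨L, hL, hmem⟩ := h
  obtain ⟨M, hM, hmem'⟩ := h'
  exact ⟨L ++ M, hL.append hM, List.mem_append_left _ hmem, List.mem_append_right _ hmem'⟩

theorem IsComputation.computes {L : List ℕ} (hL : IsComputation L) {c x y : ℕ}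
    (h : Step (fun c x y => Nat.pair c (Nat.pair x y) ∈ L) c x y) : Computes c x y :=
  ⟨_, hL.concat h, by simp⟩

theorem Computes.of_step {c x y : ℕ} (h : Step Computes c x y) : Computes c x y := by
  cases h with
  | zero => exact IsComputation.nil.computes (.zero _)
  | succ => exact IsComputation.nil.computes (.succ _)
  | left => exact IsComputation.nil.computes (.left _ _)
  | right => exact IsComputation.nil.computes (.right _ _)
  | precZero h => obtain ⟨L, hL, h⟩ := h; exact hL.computes (.precZero h)
  | found h => obtain ⟨L, hL, h⟩ := h; exact hL.computes (.found h)
  | pair h h' => obtain ⟨L, hL, h, h'⟩ := h.exists_common h'; exact hL.computes (.pair h h')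
  | comp h h' => obtain ⟨L, hL, h, h'⟩ := h.exists_common h'; exact hL.computes (.comp h h')
  | precSucc h h' =>
    obtain ⟨L, hL, h, h'⟩ := h.exists_common h'; exact hL.computes (.precSucc h h')
  | next h h' => obtain ⟨L, hL, h, h'⟩ := h.exists_common h'; exact hL.computes (.next h h')

open Nat.Partrec (Code)

section Encode

open Encodable

variable (f g : Code)

theorem encode_pair : encode (f.pair g) = 4 * Nat.pair (encode f) (encode g) + 4 := by
  simp only [Code.encodeCode_eq, Code.encodeCode]; ring

theorem encode_comp : encode (f.comp g) = 4 * Nat.pair (encode f) (encode g) + 6 := by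
  simp only [Code.encodeCode_eq, Code.encodeCode]; ring

theorem encode_prec : encode (f.prec g) = 4 * Nat.pair (encode f) (encode g) + 5 := by
  simp only [Code.encodeCode_eq, Code.encodeCode]; ring

theorem encode_rfind' : encode f.rfind' = 4 * encode f + 7 := by
  simp only [Code.encodeCode_eq, Code.encodeCode]; ring

end Encode

theorem Computes.prec {f g : Code}
    (hf : ∀ {x y}, y ∈ f.eval x → Computes (Encodable.encode f) x y)
    (hg : ∀ {x y}, y ∈ g.eval x → Computes (Encodable.encode g) x y) {a m y : ℕ}
    (h : y ∈ (f.prec g).eval (Nat.pair a m)) :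
    Computes (Encodable.encode (f.prec g)) (Nat.pair a m) y := by
  rw [encode_prec]
  induction m generalizing y with
  | zero =>
    rw [Code.eval_prec_zero] at h
    exact .of_step (.precZero (hf h))
  | succ m ih =>
    obtain ⟨i, hi, hy⟩ : ∃ i ∈ (f.prec g).eval (Nat.pair a m),
        y ∈ g.eval (Nat.pair a (Nat.pair m i)) := by
      simpa [Code.eval_prec_succ] using h
    exact .of_step (.precSucc (ih hi) (hg hy))

theorem mem_eval_rfind' {f : Code} {a m y : ℕ} :
    y ∈ f.rfind'.eval (Nat.pair a m) ↔ ∃ n, n + m = y ∧ 0 ∈ f.eval (Nat.pair a (n + m)) ∧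
      ∀ j < n, ∃ w, w + 1 ∈ f.eval (Nat.pair a (j + m)) := by
  have mem_map_iff (S : Part ℕ) : false ∈ S.map (fun w => decide (w = 0)) ↔ ∃ w, w + 1 ∈ S := by
    simp only [Part.mem_map_iff, decide_eq_false_iff_not]
    exact ⟨fun ⟨w, hw, h0⟩ => ⟨w - 1, by rwa [Nat.sub_add_cancel (Nat.pos_of_ne_zero h0)]⟩,
      fun ⟨w, hw⟩ => ⟨_, hw, w.succ_ne_zero⟩⟩
  calc y ∈ f.rfind'.eval (Nat.pair a m)
    _ ↔ ∃ n, n ∈ Nat.rfind (fun n => (f.eval (Nat.pair a (n + m))).map fun w => decide (w = 0)) ∧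
        n + m = y := by simp [Code.eval]
    _ ↔ _ := exists_congr fun n => and_comm.trans <| and_congr_right fun _ =>
        Nat.mem_rfind.trans <| and_congr (by simp) (forall₂_congr fun _ _ => mem_map_iff _)

theorem Computes.rfind' {f : Code}
    (hf : ∀ {x y}, y ∈ f.eval x → Computes (Encodable.encode f) x y) {a m n : ℕ}
    (hfound : 0 ∈ f.eval (Nat.pair a (n + m)))
    (hnext : ∀ j < n, ∃ w, w + 1 ∈ f.eval (Nat.pair a (j + m))) :
    Computes (Encodable.encode f.rfind') (Nat.pair a m) (n + m) := by
  rw [encode_rfind']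
  induction n generalizing m with
  | zero =>
    rw [Nat.zero_add] at hfound ⊢
    exact .of_step (.found (hf hfound))
  | succ n ih =>
    obtain ⟨w, hw⟩ := hnext 0 n.succ_pos
    rw [Nat.zero_add] at hw
    rw [Nat.add_right_comm, Nat.add_assoc] at hfound ⊢
    refine .of_step (.next (hf hw) (ih hfound fun j hj => ?_))
    rw [← Nat.add_assoc, Nat.add_right_comm]
    exact hnext _ (Nat.succ_lt_succ hj)

theorem Computes.of_mem_eval (c : Code) {x y : ℕ} (h : y ∈ c.eval x) :
    Computes (Encodable.encode c) x y := by
  induction c generalizing x y with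
  | zero =>
    obtain rfl : y = 0 := by simpa [Code.eval, pure, PFun.pure] using h
    exact .of_step (.zero _)
  | succ =>
    obtain rfl : y = x + 1 := by simpa [Code.eval] using h
    exact .of_step (.succ _)
  | left =>
    obtain ⟨a, b, rfl⟩ : ∃ a b, x = Nat.pair a b := ⟨_, _, (Nat.pair_unpair x).symm⟩
    obtain rfl : y = a := by simpa [Code.eval] using h
    exact .of_step (.left _ _)
  | right =>
    obtain ⟨a, b, rfl⟩ : ∃ a b, x = Nat.pair a b := ⟨_, _, (Nat.pair_unpair x).symm⟩
    obtain rfl : y = b := by simpa [Code.eval] using h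
    exact .of_step (.right _ _)
  | pair f g ihf ihg =>
    obtain ⟨a, ha, b, hb, rfl⟩ : ∃ a ∈ f.eval x, ∃ b ∈ g.eval x, Nat.pair a b = y := by
      simpa [Code.eval, Seq.seq] using h
    exact encode_pair f g ▸ .of_step (.pair (ihf ha) (ihg hb))
  | comp f g ihf ihg =>
    obtain ⟨z, hz, hy⟩ : ∃ z ∈ g.eval x, y ∈ f.eval z := Part.mem_bind_iff.1 h
    exact encode_comp f g ▸ .of_step (.comp (ihg hz) (ihf hy))
  | prec f g ihf ihg =>
    obtain ⟨a, m, rfl⟩ : ∃ a m, x = Nat.pair a m := ⟨_, _, (Nat.pair_unpair x).symm⟩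
    exact .prec ihf ihg h
  | rfind' f ih =>
    obtain ⟨a, m, rfl⟩ : ∃ a m, x = Nat.pair a m := ⟨_, _, (Nat.pair_unpair x).symm⟩
    obtain ⟨n, rfl, hfound, hnext⟩ := mem_eval_rfind'.1 h
    exact .rfind' ih hfound hnext

theorem IsComputation.sat_progF {L : List ℕ} (hL : IsComputation L) {ρ : ℕ → ℕ} {e x y : Tm}
    (h : Nat.pair (e.val ρ) (Nat.pair (x.val ρ) (y.val ρ)) ∈ L) : Sat ρ (progF e x y) := by
  have beta_unbeta (k) (h : k < L.length) : Nat.beta (Nat.unbeta L) k = L[k] :=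
    Nat.beta_unbeta_coe L ⟨k, h⟩
  simp only [progF, sat_exs_succ, sat_exs_zero, sat_and, sat_all, sat_imp]
  refine ⟨Nat.unbeta L, L.length, ?_, fun k hk => ?_⟩
  · obtain ⟨j, hj, hLj⟩ := List.getElem_of_mem h
    simpa using ⟨j, hj, by rw [beta_unbeta j hj, hLj]⟩
  · have hk : k < L.length := by simpa using hk
    obtain ⟨c, x, y, hLk, hstep⟩ := hL.exists_step hk
    refine ⟨c, x, y, by simpa [beta_unbeta k hk] using hLk, sat_stepF_of_step ?_⟩
    refine Step.mono (fun c x y h => ?_) (by simpa using hstep)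
    obtain ⟨j, hj, hLj⟩ := h
    simpa using ⟨j, hj, by rw [beta_unbeta j (hj.trans hk), hLj]⟩

theorem sat_progF_of_mem_prog {ρ : ℕ → ℕ} {e x y : Tm}
    (h : y.val ρ ∈ prog (e.val ρ) (x.val ρ)) : Sat ρ (progF e x y) := by
  obtain ⟨L, hL, hmem⟩ := Computes.of_mem_eval _ h
  rw [Denumerable.encode_ofNat] at hmem
  exact hL.sat_progF hmem

theorem sat_aboveF_of_lists {ρ : ℕ → ℕ} {e p q : Tm} {a b : ℕ} (h : Lists (e.val ρ) a b)
    (hlt : p.val ρ * (b + 1) < a * q.val ρ) : Sat ρ (aboveF e p q) := by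
  obtain ⟨hab, n, hn⟩ := h
  have hprog := sat_progF_of_mem_prog (ρ := insertAt 0 (Nat.pair a b)
    (insertAt 0 n (insertAt 0 b (insertAt 0 a ρ)))) (e := (e.up 2).up 2) (x := v 1) (y := v 0)
    (by simpa using hn)
  simp only [aboveF, listsF, sat_exs_succ, sat_exs_zero, sat_and]
  exact ⟨a, b, ⟨by simpa using hab, n, Nat.pair a b, by simp, hprog⟩, by simpa using hlt⟩

theorem exists_lists_of_lt_ceReal {e p q : ℕ} (hq : 0 < q) (h : (p : ℝ) / q < ceReal e) :
    ∃ a b, Lists e a b ∧ p * (b + 1) < a * q := by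
  have hne : {x : ℝ | ∃ a b, Lists e a b ∧ x = a / (b + 1)}.Nonempty := by
    by_contra hne
    rw [Set.not_nonempty_iff_eq_empty] at hne
    rw [ceReal, hne, Real.sSup_empty] at h
    exact absurd h (not_lt.2 (by positivity))
  obtain ⟨_, ⟨a, b, hab, rfl⟩, hlt⟩ := exists_lt_of_lt_csSup hne h
  rw [div_lt_div_iff₀ (by exact_mod_cast hq) (by positivity)] at hlt
  exact ⟨a, b, hab, by exact_mod_cast hlt⟩

theorem not_sat_belowF_one_one {ρ : ℕ → ℕ} {e : Tm} (h : 1 ≤ ceReal (e.val ρ)) :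
    ¬ Sat ρ (belowF e 1 1) := by
  simp only [belowF, sat_and, sat_exs_succ, sat_exs_zero, sat_neg]
  rintro ⟨p, q, hq, hpq, hn⟩
  replace hq : 0 < q := by simpa using hq
  replace hpq : p < q := by simpa using hpq
  have hlt : (p : ℝ) / q < ceReal (e.val ρ) :=
    ((div_lt_one (by exact_mod_cast hq)).2 (by exact_mod_cast hpq)).trans_le h
  obtain ⟨a, b, hab, hlt⟩ := exists_lists_of_lt_ceReal hq hlt
  exact hn (sat_aboveF_of_lists (by simpa using hab) (by simpa using hlt))

theorem not_provablyRandom_of_one_le_ceReal {e : ℕ} (h : 1 ≤ ceReal e) :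
    ¬ ProvablyRandom e := by
  rintro ⟨hunit, -⟩
  have hsat := (sat_subst ..).1 (hunit.sat fun _ => 0)
  rw [unitF, sat_and] at hsat
  exact not_sat_belowF_one_one (by simpa using h) hsat.2

/-! ## Horn clauses over the pairing function -/

/-- Expressions for numbers built from variables, constants, successor and pairing. -/
inductive Pat : Type
  | x (i : ℕ) : Pat
  | const (n : ℕ) : Pat
  | succ (p : Pat) : Pat
  | pair (p q : Pat) : Pat

/-- The value of an expression; variables beyond the end of the assignment `σ` get the value `0`. -/
def Pat.eval (σ : List ℕ) : Pat → ℕ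
  | x i => σ.getD i 0
  | const n => n
  | succ p => p.eval σ + 1
  | pair p q => Nat.pair (p.eval σ) (q.eval σ)

/-- An atomic formula `P(p₁, …, pₙ)` of a Horn theory with predicate symbols from `ι`. -/
abbrev Atom (ι : Type*) := ι × List Pat

/-- A closed instance of an atomic formula. -/
abbrev Fact (ι : Type*) := ι × List ℕ

/-- The instance of an atomic formula under an assignment. -/
def Atom.eval {ι : Type*} (σ : List ℕ) (A : Atom ι) : Fact ι := (A.1, A.2.map (Pat.eval σ))

/-- A Horn clause: the conjunction of `prems` implies `concl`. -/
structure Clause (ι : Type*) where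
  prems : List (Atom ι)
  concl : Atom ι

section HornTheory

variable {ι : Type*}

/-- The facts that follow from the clauses in `R`: the least set closed under their instances. -/
inductive Horn (R : List (Clause ι)) : Fact ι → Prop
  | intro {r : Clause ι} (hr : r ∈ R) (σ : List ℕ) (h : ∀ A ∈ r.prems, Horn R (A.eval σ)) :
      Horn R (r.concl.eval σ)

theorem Pat.primrec_eval (p : Pat) : Primrec fun σ : List ℕ => p.eval σ := by
  induction p with
  | x i => exact (Primrec.list_getD 0).comp Primrec.id (Primrec.const i)
  | const n => exact Primrec.const n
  | succ p ih => exact Primrec.succ.comp ih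
  | pair p q ihp ihq => exact Primrec₂.natPair.comp ihp ihq

theorem primrecRel_mem {α : Type*} [Primcodable α] : PrimrecRel fun (l : List α) a => a ∈ l :=
  Primrec.eq.exists_mem_list.of_eq fun l a => by simp

theorem Atom.primrec_eval [Primcodable ι] (A : Atom ι) : Primrec fun σ : List ℕ => A.eval σ := by
  obtain ⟨P, ps⟩ := A
  refine Primrec.pair (Primrec.const P) ?_
  induction ps with
  | nil => exact Primrec.const []
  | cons p ps ih => exact Primrec.list_cons.comp p.primrec_eval ih

theorem primrecPred_forall_mem [Primcodable ι] (As : List (Atom ι)) :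
    PrimrecPred fun z : List ℕ × List (Fact ι) => ∀ A ∈ As, A.eval z.1 ∈ z.2 := by
  induction As with
  | nil => exact (Primrec.eq.comp (Primrec.const 0) (Primrec.const 0)).of_eq fun z => by simp
  | cons A As ih =>
    exact ((primrecRel_mem.comp Primrec.snd (A.primrec_eval.comp Primrec.fst)).and ih).of_eq
      fun z => by simp

variable [DecidableEq ι]

/-- The facts that follow in one step from facts in `l`, using instances of the clauses in `R`
under the assignment `σ`. -/
def fire (R : List (Clause ι)) (σ : List ℕ) (l : List (Fact ι)) : List (Fact ι) :=
  R.flatMap fun r => if ∀ A ∈ r.prems, A.eval σ ∈ l then [r.concl.eval σ] else []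

/-- The facts obtained by successively using the assignments in a list, the last one first. -/
def derive (R : List (Clause ι)) (L : List (List ℕ)) : List (Fact ι) :=
  L.foldr (fun σ l => fire R σ l ++ l) []

theorem mem_fire {R : List (Clause ι)} {σ : List ℕ} {l : List (Fact ι)} {a : Fact ι} :
    a ∈ fire R σ l ↔ ∃ r ∈ R, (∀ A ∈ r.prems, A.eval σ ∈ l) ∧ a = r.concl.eval σ := by
  simp only [fire, List.mem_flatMap]
  refine exists_congr fun r => and_congr_right fun _ => ?_
  split_ifs with h
  · rw [List.mem_singleton, and_iff_right h]
  · exact ⟨fun h' => absurd h' List.not_mem_nil, fun h' => absurd h'.1 h⟩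

theorem mem_derive_cons {R : List (Clause ι)} {σ : List ℕ} {L : List (List ℕ)} {a : Fact ι} :
    a ∈ derive R (σ :: L) ↔
      (∃ r ∈ R, (∀ A ∈ r.prems, A.eval σ ∈ derive R L) ∧ a = r.concl.eval σ) ∨
        a ∈ derive R L := by
  simp only [derive, List.foldr_cons, List.mem_append, mem_fire]

theorem derive_subset_of_sublist (R : List (Clause ι)) {L M : List (List ℕ)} (h : L.Sublist M) :
    derive R L ⊆ derive R M := by
  induction h with
  | slnil => exact List.Subset.refl _
  | cons σ _ ih => exact fun a ha => mem_derive_cons.2 (.inr (ih ha))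
  | cons_cons σ _ ih =>
    refine fun a ha => mem_derive_cons.2 ((mem_derive_cons.1 ha).imp ?_ (ih ·))
    exact fun ⟨r, hr, hprems, ha⟩ => ⟨r, hr, fun A hA => ih (hprems A hA), ha⟩

theorem exists_forall_mem_derive {R : List (Clause ι)} {l : List (Fact ι)}
    (h : ∀ a ∈ l, ∃ L, a ∈ derive R L) : ∃ L, ∀ a ∈ l, a ∈ derive R L := by
  induction l with
  | nil => exact ⟨[], by simp⟩
  | cons a l ih =>
    obtain ⟨⟨L, hL⟩, hl⟩ := List.forall_mem_cons.1 h
    obtain ⟨M, hM⟩ := ih hl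
    exact ⟨L ++ M, List.forall_mem_cons.2
      ⟨derive_subset_of_sublist R (List.sublist_append_left L M) hL,
        fun b hb => derive_subset_of_sublist R (List.sublist_append_right L M) (hM b hb)⟩⟩

theorem Horn.exists_mem_derive {R : List (Clause ι)} {a : Fact ι} (h : Horn R a) :
    ∃ L, a ∈ derive R L := by
  induction h with
  | @intro r hr σ _ ih =>
    obtain ⟨L, hL⟩ := exists_forall_mem_derive (List.forall_mem_map.2 ih)
    exact ⟨σ :: L, mem_derive_cons.2
      (.inl ⟨r, hr, fun A hA => hL _ (List.mem_map_of_mem hA), rfl⟩)⟩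

theorem Horn.of_mem_derive {R : List (Clause ι)} {L : List (List ℕ)} {a : Fact ι}
    (h : a ∈ derive R L) : Horn R a := by
  induction L generalizing a with
  | nil => simp [derive] at h
  | cons σ L ih =>
    rcases mem_derive_cons.1 h with ⟨r, hr, hprems, rfl⟩ | h
    · exact .intro hr σ fun A hA => ih (hprems A hA)
    · exact ih h

theorem primrec_fire [Primcodable ι] (R : List (Clause ι)) : Primrec₂ (fire R) := by
  induction R with
  | nil => exact Primrec.const []
  | cons r R ih =>
    have hconcl := r.concl.primrec_eval.comp (Primrec.fst (α := List ℕ) (β := List (Fact ι)))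
    exact Primrec.list_append.comp (Primrec.ite (primrecPred_forall_mem r.prems)
      (Primrec.list_cons.comp hconcl (Primrec.const [])) (Primrec.const [])) ih

theorem primrec_derive [Primcodable ι] (R : List (Clause ι)) : Primrec (derive R) :=
  Primrec.list_foldr (h := fun _ z => fire R z.1 z.2 ++ z.2) Primrec.id (Primrec.const [])
    (Primrec.list_append.comp ((primrec_fire R).comp (Primrec.fst.comp Primrec.snd)
      (Primrec.snd.comp Primrec.snd)) (Primrec.snd.comp Primrec.snd))

end HornTheory

theorem exists_primrec_enum_horn {ι : Type*} [Primcodable ι] (R : List (Clause ι)) (P : ι) :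
    ∃ f : ℕ → Option ℕ, Primrec f ∧ ∀ e, (∃ i, f i = some e) ↔ Horn R (P, [e]) := by
  classical
  refine ⟨fun i => if (P, [i.unpair.1]) ∈ derive R (Denumerable.ofNat _ i.unpair.2) then
    some i.unpair.1 else none, ?_, fun e => ⟨?_, fun h => ?_⟩⟩
  · have hfst : Primrec fun i : ℕ => i.unpair.1 := Primrec.fst.comp Primrec.unpair
    have hsnd : Primrec fun i : ℕ => i.unpair.2 := Primrec.snd.comp Primrec.unpair
    exact Primrec.ite (primrecRel_mem.comp ((primrec_derive R).comp ((Primrec.ofNat _).comp hsnd))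
      (Primrec.pair (Primrec.const P) (Primrec.list_cons.comp hfst (Primrec.const []))))
      (Primrec.option_some.comp hfst) (Primrec.const none)
  · rintro ⟨i, hi⟩
    simp only [Option.ite_none_right_eq_some, Option.some.injEq] at hi
    exact .of_mem_derive (hi.2 ▸ hi.1)
  · obtain ⟨L, hL⟩ := h.exists_mem_derive
    exact ⟨Nat.pair e (Encodable.encode L), by simpa using hL⟩

/-! ## Provability as a Horn theory -/

/-- The code of a term: a tag for its outermost symbol, paired with the codes of its parts. -/
def Tm.code : Tm → ℕ
  | var i => Nat.pair 1 i + 1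
  | zero => 0
  | one => Nat.pair 0 0 + 1
  | add t u => Nat.pair 2 (Nat.pair t.code u.code) + 1
  | mul t u => Nat.pair 3 (Nat.pair t.code u.code) + 1

/-- The code of a formula, built in the same way as that of a term. -/
def Fml.code : Fml → ℕ
  | bot => 0
  | eq t u => Nat.pair 0 (Nat.pair t.code u.code) + 1
  | lt t u => Nat.pair 1 (Nat.pair t.code u.code) + 1
  | imp φ ψ => Nat.pair 2 (Nat.pair φ.code ψ.code) + 1
  | all φ => Nat.pair 3 φ.code + 1

/-- A left inverse of `Tm.code`, total so that every number stands for a term. -/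
def decodeTm : ℕ → Tm
  | 0 => .zero
  | n + 1 =>
    have _ : n.unpair.2.unpair.1 ≤ n := (Nat.unpair_left_le _).trans (Nat.unpair_right_le _)
    have _ : n.unpair.2.unpair.2 ≤ n := (Nat.unpair_right_le _).trans (Nat.unpair_right_le _)
    match n.unpair.1 with
    | 0 => .one
    | 1 => .var n.unpair.2
    | 2 => .add (decodeTm n.unpair.2.unpair.1) (decodeTm n.unpair.2.unpair.2)
    | _ => .mul (decodeTm n.unpair.2.unpair.1) (decodeTm n.unpair.2.unpair.2)

/-- A left inverse of `Fml.code`, total so that every number stands for a formula. -/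
def decodeFml : ℕ → Fml
  | 0 => bot
  | n + 1 =>
    have _ : n.unpair.2 ≤ n := Nat.unpair_right_le _
    have _ : n.unpair.2.unpair.1 ≤ n := (Nat.unpair_left_le _).trans (Nat.unpair_right_le _)
    have _ : n.unpair.2.unpair.2 ≤ n := (Nat.unpair_right_le _).trans (Nat.unpair_right_le _)
    match n.unpair.1 with
    | 0 => eq (decodeTm n.unpair.2.unpair.1) (decodeTm n.unpair.2.unpair.2)
    | 1 => lt (decodeTm n.unpair.2.unpair.1) (decodeTm n.unpair.2.unpair.2)
    | 2 => imp (decodeFml n.unpair.2.unpair.1) (decodeFml n.unpair.2.unpair.2)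
    | _ => all (decodeFml n.unpair.2)

@[simp] theorem decodeTm_zero : decodeTm 0 = .zero := by rw [decodeTm]

@[simp] theorem decodeTm_one : decodeTm (Nat.pair 0 0 + 1) = .one := by rw [decodeTm]; simp

@[simp] theorem decodeTm_var (i : ℕ) : decodeTm (Nat.pair 1 i + 1) = .var i := by
  rw [decodeTm]; simp

@[simp] theorem decodeTm_add (a b : ℕ) :
    decodeTm (Nat.pair 2 (Nat.pair a b) + 1) = .add (decodeTm a) (decodeTm b) := by
  rw [decodeTm]; simp

@[simp] theorem decodeTm_mul (a b : ℕ) :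
    decodeTm (Nat.pair 3 (Nat.pair a b) + 1) = .mul (decodeTm a) (decodeTm b) := by
  rw [decodeTm]; simp

@[simp] theorem decodeFml_bot : decodeFml 0 = bot := by rw [decodeFml]

@[simp] theorem decodeFml_eq (a b : ℕ) :
    decodeFml (Nat.pair 0 (Nat.pair a b) + 1) = eq (decodeTm a) (decodeTm b) := by
  rw [decodeFml]; simp

@[simp] theorem decodeFml_lt (a b : ℕ) :
    decodeFml (Nat.pair 1 (Nat.pair a b) + 1) = lt (decodeTm a) (decodeTm b) := by
  rw [decodeFml]; simp

@[simp] theorem decodeFml_imp (a b : ℕ) :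
    decodeFml (Nat.pair 2 (Nat.pair a b) + 1) = imp (decodeFml a) (decodeFml b) := by
  rw [decodeFml]; simp

@[simp] theorem decodeFml_all (a : ℕ) : decodeFml (Nat.pair 3 a + 1) = all (decodeFml a) := by
  rw [decodeFml]; simp

theorem decodeTm_code (t : Tm) : decodeTm t.code = t := by
  induction t <;> simp [Tm.code, *]

@[simp] theorem decodeFml_code (φ : Fml) : decodeFml φ.code = φ := by
  induction φ <;> simp [Fml.code, decodeTm_code, *]

/-- The axioms of Peano arithmetic other than induction. -/
def finiteAxioms : List Fml :=
  [Fml.eq ((v 0 + v 1) + v 2) (v 0 + (v 1 + v 2)),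
    Fml.eq (v 0 + v 1) (v 1 + v 0),
    Fml.eq ((v 0 * v 1) * v 2) (v 0 * (v 1 * v 2)),
    Fml.eq (v 0 * v 1) (v 1 * v 0),
    Fml.eq (v 0 * (v 1 + v 2)) (v 0 * v 1 + v 0 * v 2),
    Fml.and (Fml.eq (v 0 + 0) (v 0)) (Fml.eq (v 0 * 0) 0),
    Fml.eq (v 0 * 1) (v 0),
    Fml.imp (Fml.and (Fml.lt (v 0) (v 1)) (Fml.lt (v 1) (v 2))) (Fml.lt (v 0) (v 2)),
    Fml.neg (Fml.lt (v 0) (v 0)),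
    Fml.or (Fml.lt (v 0) (v 1)) (Fml.or (Fml.eq (v 0) (v 1)) (Fml.lt (v 1) (v 0))),
    Fml.imp (Fml.lt (v 0) (v 1)) (Fml.lt (v 0 + v 2) (v 1 + v 2)),
    Fml.imp (Fml.and (Fml.lt 0 (v 2)) (Fml.lt (v 0) (v 1))) (Fml.lt (v 0 * v 2) (v 1 * v 2)),
    Fml.imp (Fml.lt (v 0) (v 1)) (Fml.ex (Fml.eq (v 1 + v 0) (v 2))),
    Fml.and (Fml.lt 0 1) (Fml.imp (Fml.lt 0 (v 0)) (Fml.or (Fml.lt 1 (v 0)) (Fml.eq 1 (v 0)))),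
    Fml.or (Fml.lt 0 (v 0)) (Fml.eq 0 (v 0))]

theorem paAxiom_iff {φ : Fml} : PAAxiom φ ↔ φ ∈ finiteAxioms ∨
    ∃ ψ : Fml, φ = imp (ψ.subst 0 0)
      (imp (all (imp ψ ((ψ.lift 1).subst 0 (v 0 + 1)))) (all ψ)) := by
  constructor
  · intro h
    cases h with
    | induction ψ => exact .inr ⟨ψ, rfl⟩
    | _ => left; simp [finiteAxioms]
  · rintro (h | ⟨ψ, rfl⟩)
    · simp only [finiteAxioms, List.mem_cons, List.not_mem_nil, or_false] at h
      rcases h with rfl | rfl | rfl | rfl | rfl | rfl | rfl | rfl | rfl | rfl | rfl | rfl | rfl |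
        rfl | rfl <;> constructor
    · exact .induction ψ

/-- The predicate symbols of the Horn theory of provability; `Holds` gives their meaning. -/
inductive Rel : Type
  | lt | num | liftTm | substTm | liftFml | substFml | proved | random

instance : Primcodable Rel := .ofEquiv _ (proxy_equiv% Rel).symm

/-- The intended meaning of the facts of the Horn theory of provability. -/
def Holds : Fact Rel → Prop
  | (.lt, [a, b]) => a < b
  | (.num, [n, t]) => decodeTm t = num n
  | (.liftTm, [k, t, t']) => decodeTm t' = (decodeTm t).lift k
  | (.substTm, [k, s, t, t']) => decodeTm t' = Tm.subst k (decodeTm s) (decodeTm t)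
  | (.liftFml, [k, φ, φ']) => decodeFml φ' = (decodeFml φ).lift k
  | (.substFml, [k, s, φ, φ']) => decodeFml φ' = (decodeFml φ).subst k (decodeTm s)
  | (.proved, [φ]) => PAProves (decodeFml φ)
  | (.random, [e]) => ProvablyRandom e
  | _ => False

namespace Pat

/-- The code of the constant `1`. -/
abbrev one : Pat := succ (pair (const 0) (const 0))
/-- The code of a variable. -/
abbrev var (p : Pat) : Pat := succ (pair (const 1) p)
/-- The code of a sum. -/
abbrev add (p q : Pat) : Pat := succ (pair (const 2) (pair p q))
/-- The code of a product. -/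
abbrev mul (p q : Pat) : Pat := succ (pair (const 3) (pair p q))
/-- The code of an equation. -/
abbrev eq (p q : Pat) : Pat := succ (pair (const 0) (pair p q))
/-- The code of an inequality. -/
abbrev lt (p q : Pat) : Pat := succ (pair (const 1) (pair p q))
/-- The code of an implication. -/
abbrev imp (p q : Pat) : Pat := succ (pair (const 2) (pair p q))
/-- The code of a universal formula. -/
abbrev all (p : Pat) : Pat := succ (pair (const 3) p)

end Pat

section Rules

open Pat (x const succ)

/-- The names of the clauses about numbers and terms. -/
inductive TmRule : Type
  | ltZero | ltSucc | numZero | numSucc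
  | liftVarLt | liftVarGe | liftZero | liftOne | liftAdd | liftMul
  | substVarLt | substVarEq | substVarGt | substZero | substOne | substAdd | substMul

instance : Fintype TmRule := derive_fintype% TmRule

/-- The clauses about numbers and terms. -/
def TmRule.clause : TmRule → Clause Rel
  | ltZero => ⟨[], (.lt, [const 0, succ (x 0)])⟩
  | ltSucc => ⟨[(.lt, [x 0, x 1])], (.lt, [succ (x 0), succ (x 1)])⟩
  | numZero => ⟨[], (.num, [const 0, const 0])⟩
  | numSucc => ⟨[(.num, [x 0, x 1])], (.num, [succ (x 0), .add (x 1) .one])⟩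
  | liftVarLt => ⟨[(.lt, [x 1, x 0])], (.liftTm, [x 0, .var (x 1), .var (x 1)])⟩
  | liftVarGe => ⟨[(.lt, [x 0, succ (x 1)])], (.liftTm, [x 0, .var (x 1), .var (succ (x 1))])⟩
  | liftZero => ⟨[], (.liftTm, [x 0, const 0, const 0])⟩
  | liftOne => ⟨[], (.liftTm, [x 0, .one, .one])⟩
  | liftAdd => ⟨[(.liftTm, [x 0, x 1, x 3]), (.liftTm, [x 0, x 2, x 4])],
      (.liftTm, [x 0, .add (x 1) (x 2), .add (x 3) (x 4)])⟩
  | liftMul => ⟨[(.liftTm, [x 0, x 1, x 3]), (.liftTm, [x 0, x 2, x 4])],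
      (.liftTm, [x 0, .mul (x 1) (x 2), .mul (x 3) (x 4)])⟩
  | substVarLt => ⟨[(.lt, [x 2, x 0])], (.substTm, [x 0, x 1, .var (x 2), .var (x 2)])⟩
  | substVarEq => ⟨[], (.substTm, [x 0, x 1, .var (x 0), x 1])⟩
  | substVarGt =>
    ⟨[(.lt, [x 0, succ (x 2)])], (.substTm, [x 0, x 1, .var (succ (x 2)), .var (x 2)])⟩
  | substZero => ⟨[], (.substTm, [x 0, x 1, const 0, const 0])⟩
  | substOne => ⟨[], (.substTm, [x 0, x 1, .one, .one])⟩
  | substAdd => ⟨[(.substTm, [x 0, x 1, x 2, x 4]), (.substTm, [x 0, x 1, x 3, x 5])],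
      (.substTm, [x 0, x 1, .add (x 2) (x 3), .add (x 4) (x 5)])⟩
  | substMul => ⟨[(.substTm, [x 0, x 1, x 2, x 4]), (.substTm, [x 0, x 1, x 3, x 5])],
      (.substTm, [x 0, x 1, .mul (x 2) (x 3), .mul (x 4) (x 5)])⟩

/-- The names of the clauses about lifting and substitution in formulas. -/
inductive FmlRule : Type
  | liftBot | liftEq | liftLt | liftImp | liftAll
  | substBot | substEq | substLt | substImp | substAll

instance : Fintype FmlRule := derive_fintype% FmlRule

/-- The clauses about lifting and substitution in formulas. -/
def FmlRule.clause : FmlRule → Clause Rel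
  | liftBot => ⟨[], (.liftFml, [x 0, const 0, const 0])⟩
  | liftEq => ⟨[(.liftTm, [x 0, x 1, x 3]), (.liftTm, [x 0, x 2, x 4])],
      (.liftFml, [x 0, .eq (x 1) (x 2), .eq (x 3) (x 4)])⟩
  | liftLt => ⟨[(.liftTm, [x 0, x 1, x 3]), (.liftTm, [x 0, x 2, x 4])],
      (.liftFml, [x 0, .lt (x 1) (x 2), .lt (x 3) (x 4)])⟩
  | liftImp => ⟨[(.liftFml, [x 0, x 1, x 3]), (.liftFml, [x 0, x 2, x 4])],
      (.liftFml, [x 0, .imp (x 1) (x 2), .imp (x 3) (x 4)])⟩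
  | liftAll => ⟨[(.liftFml, [succ (x 0), x 1, x 2])], (.liftFml, [x 0, .all (x 1), .all (x 2)])⟩
  | substBot => ⟨[], (.substFml, [x 0, x 1, const 0, const 0])⟩
  | substEq => ⟨[(.substTm, [x 0, x 1, x 2, x 4]), (.substTm, [x 0, x 1, x 3, x 5])],
      (.substFml, [x 0, x 1, .eq (x 2) (x 3), .eq (x 4) (x 5)])⟩
  | substLt => ⟨[(.substTm, [x 0, x 1, x 2, x 4]), (.substTm, [x 0, x 1, x 3, x 5])],
      (.substFml, [x 0, x 1, .lt (x 2) (x 3), .lt (x 4) (x 5)])⟩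
  | substImp => ⟨[(.substFml, [x 0, x 1, x 2, x 4]), (.substFml, [x 0, x 1, x 3, x 5])],
      (.substFml, [x 0, x 1, .imp (x 2) (x 3), .imp (x 4) (x 5)])⟩
  | substAll => ⟨[(.liftTm, [const 0, x 1, x 4]), (.substFml, [succ (x 0), x 4, x 2, x 3])],
      (.substFml, [x 0, x 1, .all (x 2), .all (x 3)])⟩

/-- The names of the clauses about provability in Peano arithmetic. -/
inductive ProofRule : Type
  | peano (i : Fin finiteAxioms.length) | induction
  | k | s | dne | inst | distrib | vacuous | refl | leibniz | mp | gen

instance : Fintype ProofRule := derive_fintype% ProofRule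

/-- The clauses about provability in Peano arithmetic. -/
def ProofRule.clause : ProofRule → Clause Rel
  | peano i => ⟨[], (.proved, [const finiteAxioms[i].code])⟩
  | induction => ⟨[(.substFml, [const 0, const 0, x 0, x 1]), (.liftFml, [const 1, x 0, x 2]),
      (.substFml, [const 0, .add (.var (const 0)) .one, x 2, x 3])],
      (.proved, [.imp (x 1) (.imp (.all (.imp (x 0) (x 3))) (.all (x 0)))])⟩
  | k => ⟨[], (.proved, [.imp (x 0) (.imp (x 1) (x 0))])⟩
  | s => ⟨[], (.proved, [.imp (.imp (x 0) (.imp (x 1) (x 2)))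
      (.imp (.imp (x 0) (x 1)) (.imp (x 0) (x 2)))])⟩
  | dne => ⟨[], (.proved, [.imp (.imp (.imp (x 0) (const 0)) (const 0)) (x 0)])⟩
  | inst => ⟨[(.substFml, [const 0, x 1, x 0, x 2])], (.proved, [.imp (.all (x 0)) (x 2)])⟩
  | distrib => ⟨[], (.proved, [.imp (.all (.imp (x 0) (x 1))) (.imp (.all (x 0)) (.all (x 1)))])⟩
  | vacuous => ⟨[(.liftFml, [const 0, x 0, x 1])], (.proved, [.imp (x 0) (.all (x 1))])⟩
  | refl => ⟨[], (.proved, [.eq (x 0) (x 0)])⟩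
  | leibniz => ⟨[(.substFml, [const 0, x 1, x 0, x 3]), (.substFml, [const 0, x 2, x 0, x 4])],
      (.proved, [.imp (.eq (x 1) (x 2)) (.imp (x 3) (x 4))])⟩
  | mp => ⟨[(.proved, [.imp (x 0) (x 1)]), (.proved, [x 0])], (.proved, [x 1])⟩
  | gen => ⟨[(.proved, [x 0])], (.proved, [.all (x 0)])⟩

/-- The names of all clauses; the last two are the two ways of being provably random. -/
inductive Rule : Type
  | tm (r : TmRule) | fml (r : FmlRule) | proof (r : ProofRule) | chaitin | solovay

instance : Fintype Rule := derive_fintype% Rule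

/-- The clause stating that `e` is provably random if Peano arithmetic proves `α` and `φ` of it. -/
def randomClause (α φ : Fml) : Clause Rel :=
  ⟨[(.num, [x 0, x 1]),
    (.substFml, [const 0, x 1, const α.code, x 2]), (.proved, [x 2]),
    (.substFml, [const 0, x 1, const φ.code, x 3]), (.proved, [x 3])], (.random, [x 0])⟩

/-- The clauses of the Horn theory of provability. -/
def Rule.clause : Rule → Clause Rel
  | tm r => r.clause
  | fml r => r.clause
  | proof r => r.clause
  | chaitin => randomClause (unitF (v 0)) (chaitinF (v 0))
  | solovay => randomClause (unitF (v 0)) (solovayF (v 0))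

/-- The Horn theory of provability. -/
noncomputable def rules : List (Clause Rel) := Finset.univ.toList.map Rule.clause

/-- A clause all of whose instances are correct. -/
def Clause.Sound (r : Clause Rel) : Prop :=
  ∀ σ, (r.prems.map (Atom.eval σ)).Forall Holds → Holds (r.concl.eval σ)

section Soundness

attribute [local simp] Clause.Sound Atom.eval Pat.eval Holds

theorem TmRule.sound (r : TmRule) : r.clause.Sound := by
  cases r with
  | ltZero => simp [clause]
  | ltSucc => simp [clause]
  | numZero => simp [clause, num, show (0 : Tm) = .zero from rfl]
  | numSucc => simp +contextual [clause, num,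
      show ∀ t : Tm, t + 1 = .add t .one from fun _ => rfl]
  | liftVarLt => simp +contextual [clause, Tm.lift]
  | liftVarGe => simp [clause, Tm.lift]
  | liftZero => simp [clause, Tm.lift]
  | liftOne => simp [clause, Tm.lift]
  | liftAdd => simp +contextual [clause, Tm.lift]
  | liftMul => simp +contextual [clause, Tm.lift]
  | substVarLt => simp +contextual [clause, Tm.subst]
  | substVarEq => simp [clause, Tm.subst]
  | substVarGt =>
    rintro σ (h : σ.getD 0 0 < σ.getD 2 0 + 1)
    simp [clause, Tm.subst, h.not_gt, h.ne', -List.getD_eq_getElem?_getD]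
  | substZero => simp [clause, Tm.subst]
  | substOne => simp [clause, Tm.subst]
  | substAdd => simp +contextual [clause, Tm.subst]
  | substMul => simp +contextual [clause, Tm.subst]

theorem FmlRule.sound (r : FmlRule) : r.clause.Sound := by
  cases r <;> simp +contextual [clause, Fml.lift, Fml.subst]

theorem ProofRule.sound (r : ProofRule) : r.clause.Sound := by
  cases r with
  | peano i => simpa [clause] using .ax (paAxiom_iff.2 (.inl (List.getElem_mem _)))
  | induction => simpa +contextual [clause] using fun _ _ _ _ => .ax (.induction _)
  | k => simpa [clause] using fun _ => .k _ _
  | s => simpa [clause] using fun _ => .s _ _ _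
  | dne => simpa [clause] using fun _ => .dne _
  | inst => simpa +contextual [clause] using fun _ _ => .inst _ _
  | distrib => simpa [clause] using fun _ => .distrib _ _
  | vacuous => simpa +contextual [clause] using fun _ _ => .vacuous _
  | refl => simpa [clause] using fun _ => .refl _
  | leibniz => simpa +contextual [clause] using fun _ _ _ => .leibniz _ _ _
  | mp => simpa [clause] using fun _ => .mp
  | gen => simpa [clause] using fun _ => .gen

theorem sound_randomClause {α φ : Fml}
    (h : ∀ e, PAProves (α.subst 0 (num e)) → PAProves (φ.subst 0 (num e)) → ProvablyRandom e) :
    (randomClause α φ).Sound := by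
  intro σ
  simp only [randomClause, List.map_cons, List.map_nil, List.forall_cons, List.Forall, Atom.eval,
    Pat.eval, Holds, decodeFml_code]
  rintro ⟨hnum, hα, hα', hφ, hφ'⟩
  rw [hα, hnum] at hα'
  rw [hφ, hnum] at hφ'
  exact h _ hα' hφ'

end Soundness

theorem Rule.sound (r : Rule) : r.clause.Sound := by
  cases r with
  | tm r => exact r.sound
  | fml r => exact r.sound
  | proof r => exact r.sound
  | chaitin => exact sound_randomClause (φ := chaitinF (v 0)) fun _ hunit h => ⟨hunit, .inl h⟩
  | solovay => exact sound_randomClause (φ := solovayF (v 0)) fun _ hunit h => ⟨hunit, .inr h⟩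

theorem Horn.holds {a : Fact Rel} (h : Horn rules a) : Holds a := by
  induction h with
  | intro hr σ _ ih =>
    obtain ⟨r, -, rfl⟩ := List.mem_map.1 hr
    exact r.sound σ (List.forall_iff_forall_mem.2 (List.forall_mem_map.2 ih))

theorem Horn.rule (r : Rule) (σ : List ℕ)
    (h : (r.clause.prems.map (Atom.eval σ)).Forall (Horn rules)) :
    Horn rules (r.clause.concl.eval σ) :=
  .intro (List.mem_map_of_mem (Finset.mem_toList.2 (Finset.mem_univ r))) σ
    (List.forall_mem_map.1 (List.forall_iff_forall_mem.1 h))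

theorem horn_lt {i k : ℕ} (h : i < k) : Horn rules (.lt, [i, k]) := by
  obtain ⟨d, rfl⟩ := Nat.exists_eq_add_of_lt h
  clear h
  induction i with
  | zero => exact .rule (.tm .ltZero) [0 + d] trivial
  | succ i ih =>
    rw [show i + 1 + d + 1 = i + d + 1 + 1 by ring]
    exact .rule (.tm .ltSucc) [i, i + d + 1] ih

theorem horn_num (n : ℕ) : Horn rules (.num, [n, (num n).code]) := by
  induction n with
  | zero => exact .rule (.tm .numZero) [] trivial
  | succ n ih => exact .rule (.tm .numSucc) [n, (num n).code] ih

theorem horn_liftTm (k : ℕ) (t : Tm) : Horn rules (.liftTm, [k, t.code, (t.lift k).code]) := by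
  induction t with
  | var i =>
    rw [Tm.lift]
    split_ifs with hi
    · exact .rule (.tm .liftVarLt) [k, i] (horn_lt hi)
    · exact .rule (.tm .liftVarGe) [k, i] (horn_lt (Nat.lt_succ_of_le (not_lt.1 hi)))
  | zero => exact .rule (.tm .liftZero) [k] trivial
  | one => exact .rule (.tm .liftOne) [k] trivial
  | add t u iht ihu =>
    exact .rule (.tm .liftAdd) [k, t.code, u.code, (t.lift k).code, (u.lift k).code] ⟨iht, ihu⟩
  | mul t u iht ihu =>
    exact .rule (.tm .liftMul) [k, t.code, u.code, (t.lift k).code, (u.lift k).code] ⟨iht, ihu⟩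

theorem horn_substTm (k : ℕ) (s t : Tm) :
    Horn rules (.substTm, [k, s.code, t.code, (Tm.subst k s t).code]) := by
  induction t with
  | var i =>
    rw [Tm.subst]
    split_ifs with hlt heq
    · exact .rule (.tm .substVarLt) [k, s.code, i] (horn_lt hlt)
    · exact heq ▸ .rule (.tm .substVarEq) [i, s.code] trivial
    · obtain ⟨i, rfl⟩ := Nat.exists_eq_succ_of_ne_zero (show i ≠ 0 by lia)
      exact .rule (.tm .substVarGt) [k, s.code, i] (horn_lt (show k < i + 1 by lia))
  | zero => exact .rule (.tm .substZero) [k, s.code] trivial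
  | one => exact .rule (.tm .substOne) [k, s.code] trivial
  | add t u iht ihu =>
    exact .rule (.tm .substAdd)
      [k, s.code, t.code, u.code, (Tm.subst k s t).code, (Tm.subst k s u).code] ⟨iht, ihu⟩
  | mul t u iht ihu =>
    exact .rule (.tm .substMul)
      [k, s.code, t.code, u.code, (Tm.subst k s t).code, (Tm.subst k s u).code] ⟨iht, ihu⟩

theorem horn_liftFml (k : ℕ) (φ : Fml) : Horn rules (.liftFml, [k, φ.code, (φ.lift k).code]) := by
  induction φ generalizing k with
  | bot => exact .rule (.fml .liftBot) [k] trivial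
  | eq t u =>
    exact .rule (.fml .liftEq) [k, t.code, u.code, (t.lift k).code, (u.lift k).code]
      ⟨horn_liftTm k t, horn_liftTm k u⟩
  | lt t u =>
    exact .rule (.fml .liftLt) [k, t.code, u.code, (t.lift k).code, (u.lift k).code]
      ⟨horn_liftTm k t, horn_liftTm k u⟩
  | imp φ ψ ihφ ihψ =>
    exact .rule (.fml .liftImp) [k, φ.code, ψ.code, (φ.lift k).code, (ψ.lift k).code]
      ⟨ihφ k, ihψ k⟩
  | all φ ih => exact .rule (.fml .liftAll) [k, φ.code, (φ.lift (k + 1)).code] (ih (k + 1))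

theorem horn_substFml (k : ℕ) (s : Tm) (φ : Fml) :
    Horn rules (.substFml, [k, s.code, φ.code, (φ.subst k s).code]) := by
  induction φ generalizing k s with
  | bot => exact .rule (.fml .substBot) [k, s.code] trivial
  | eq t u =>
    exact .rule (.fml .substEq)
      [k, s.code, t.code, u.code, (Tm.subst k s t).code, (Tm.subst k s u).code]
      ⟨horn_substTm k s t, horn_substTm k s u⟩
  | lt t u =>
    exact .rule (.fml .substLt)
      [k, s.code, t.code, u.code, (Tm.subst k s t).code, (Tm.subst k s u).code]
      ⟨horn_substTm k s t, horn_substTm k s u⟩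
  | imp φ ψ ihφ ihψ =>
    exact .rule (.fml .substImp)
      [k, s.code, φ.code, ψ.code, (φ.subst k s).code, (ψ.subst k s).code] ⟨ihφ k s, ihψ k s⟩
  | all φ ih =>
    exact .rule (.fml .substAll)
      [k, s.code, φ.code, (φ.subst (k + 1) (s.lift 0)).code, (s.lift 0).code]
      ⟨horn_liftTm 0 s, ih (k + 1) (s.lift 0)⟩

theorem horn_of_paAxiom {φ : Fml} (h : PAAxiom φ) : Horn rules (.proved, [φ.code]) := by
  rcases paAxiom_iff.1 h with h | ⟨ψ, rfl⟩
  · obtain ⟨i, hi, rfl⟩ := List.getElem_of_mem h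
    exact .rule (.proof (.peano ⟨i, hi⟩)) [] trivial
  · exact .rule (.proof .induction)
      [ψ.code, (ψ.subst 0 0).code, (ψ.lift 1).code, ((ψ.lift 1).subst 0 (v 0 + 1)).code]
      ⟨horn_substFml 0 0 ψ, horn_liftFml 1 ψ, horn_substFml 0 (v 0 + 1) (ψ.lift 1)⟩

theorem horn_of_paProves {φ : Fml} (h : PAProves φ) : Horn rules (.proved, [φ.code]) := by
  induction h with
  | ax h => exact horn_of_paAxiom h
  | k φ ψ => exact .rule (.proof .k) [φ.code, ψ.code] trivial
  | s φ ψ χ => exact .rule (.proof .s) [φ.code, ψ.code, χ.code] trivial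
  | dne φ => exact .rule (.proof .dne) [φ.code] trivial
  | inst φ t =>
    exact .rule (.proof .inst) [φ.code, t.code, (φ.subst 0 t).code] (horn_substFml 0 t φ)
  | distrib φ ψ => exact .rule (.proof .distrib) [φ.code, ψ.code] trivial
  | vacuous φ => exact .rule (.proof .vacuous) [φ.code, (φ.lift 0).code] (horn_liftFml 0 φ)
  | refl t => exact .rule (.proof .refl) [t.code] trivial
  | leibniz φ t u =>
    exact .rule (.proof .leibniz)
      [φ.code, t.code, u.code, (φ.subst 0 t).code, (φ.subst 0 u).code]
      ⟨horn_substFml 0 t φ, horn_substFml 0 u φ⟩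
  | @mp φ ψ _ _ ihimp ihφ => exact .rule (.proof .mp) [φ.code, ψ.code] ⟨ihimp, ihφ⟩
  | @gen φ _ ih => exact .rule (.proof .gen) [φ.code] ih

theorem forall_horn_prems_randomClause {α φ : Fml} {e : ℕ}
    (hα : PAProves (α.subst 0 (num e))) (hφ : PAProves (φ.subst 0 (num e))) :
    ((randomClause α φ).prems.map (Atom.eval [e, (num e).code,
      (α.subst 0 (num e)).code, (φ.subst 0 (num e)).code])).Forall (Horn rules) :=
  ⟨horn_num e, horn_substFml 0 _ _, horn_of_paProves hα, horn_substFml 0 _ _,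
    horn_of_paProves hφ⟩

theorem horn_random_iff {e : ℕ} : Horn rules (.random, [e]) ↔ ProvablyRandom e := by
  refine ⟨Horn.holds, ?_⟩
  rintro ⟨hunit, hchaitin | hsolovay⟩
  · exact .rule .chaitin _ (forall_horn_prems_randomClause hunit hchaitin)
  · exact .rule .solovay _ (forall_horn_prems_randomClause hunit hsolovay)

theorem exists_primrec_enum_provablyRandom :
    ∃ f : ℕ → Option ℕ, Primrec f ∧ ∀ e, (∃ i, f i = some e) ↔ ProvablyRandom e := by
  obtain ⟨f, hf, h⟩ := exists_primrec_enum_horn rules .random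
  exact ⟨f, hf, fun e => (h e).trans horn_random_iff⟩

end Rules

/-! ## Weights of prefix-free sets -/

section Weights

open InformationTheory

variable {α : Type*}

theorem uniquelyDecodable_of_isAntichain_prefix {S : Set (List α)}
    (hS : IsAntichain (· <+: ·) S) (hnil : [] ∉ S) : UniquelyDecodable S := by
  intro L₁
  induction L₁ with
  | nil =>
    rintro (_ | ⟨t, L₂⟩) - h₂ h
    · rfl
    · obtain rfl : t = [] := (List.append_eq_nil_iff.1 h.symm).1
      exact absurd (h₂ [] List.mem_cons_self) hnil
  | cons s L₁ ih =>
    rintro (_ | ⟨t, L₂⟩) h₁ h₂ h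
    · obtain rfl : s = [] := (List.append_eq_nil_iff.1 h).1
      exact absurd (h₁ [] List.mem_cons_self) hnil
    · rw [List.forall_mem_cons] at h₁ h₂
      rw [List.flatten_cons, List.flatten_cons] at h
      obtain rfl : s = t :=
        (List.prefix_or_prefix_of_prefix (List.prefix_append s _)
          (h ▸ List.prefix_append t _)).elim (hS.eq h₁.1 h₂.1) (hS.eq' h₁.1 h₂.1)
      rw [ih L₂ h₁.2 h₂.2 (List.append_cancel_left h)]

/-- The extension of `S` by those words of length `N` that have no prefix in `S`. If `S` is
prefix-free and its elements have length at most `N`, this is a maximal prefix-free set. -/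
def levelCompletion (S : Set (List α)) (N : ℕ) : Set (List α) :=
  S ∪ {w | w.length = N ∧ ∀ d ∈ S, ¬ d <+: w}

theorem isAntichain_levelCompletion {S : Set (List α)} (hS : IsAntichain (· <+: ·) S) {N : ℕ}
    (hN : ∀ s ∈ S, s.length ≤ N) : IsAntichain (· <+: ·) (levelCompletion S N) := by
  rintro s (hs | hs) t (ht | ht) hst hpre
  · exact hS hs ht hst hpre
  · exact ht.2 s hs hpre
  · exact hst (hpre.eq_of_length_le ((hN t ht).trans_eq hs.1.symm))
  · exact hst (hpre.eq_of_length (hs.1.trans ht.1.symm))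

variable [Fintype α]

theorem sum_weight_le_one [Nonempty α] {S : Finset (List α)}
    (hS : IsAntichain (· <+: ·) (S : Set (List α))) :
    ∑ s ∈ S, (1 / Fintype.card α : ℝ) ^ s.length ≤ 1 := by
  by_cases hnil : [] ∈ S
  · obtain rfl : S = {[]} := Finset.eq_singleton_iff_unique_mem.2
      ⟨hnil, fun s hs => (hS.eq hnil hs List.nil_prefix).symm⟩
    simp
  · exact kraft_mcmillan_inequality (uniquelyDecodable_of_isAntichain_prefix hS hnil)

theorem sum_subtype_weight_le_one [Nonempty α] {S : Set (List α)}
    (hS : IsAntichain (· <+: ·) S) (F : Finset S) :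
    ∑ s ∈ F, (1 / Fintype.card α : ℝ) ^ s.1.length ≤ 1 := by
  have hF : IsAntichain (· <+: ·) (F.map (Function.Embedding.subtype _) : Set (List α)) :=
    hS.subset fun s hs => by
      obtain ⟨t, -, rfl⟩ := Finset.mem_map.1 hs
      exact t.2
  simpa only [Finset.sum_map, Function.Embedding.subtype_apply] using sum_weight_le_one hF

theorem summable_weight [Nonempty α] {S : Set (List α)} (hS : IsAntichain (· <+: ·) S) :
    Summable fun s : S => (1 / Fintype.card α : ℝ) ^ s.1.length :=
  summable_of_sum_le (fun _ => by positivity) (sum_subtype_weight_le_one hS)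

theorem tsum_weight_le_one [Nonempty α] {S : Set (List α)} (hS : IsAntichain (· <+: ·) S) :
    ∑' s : S, (1 / Fintype.card α : ℝ) ^ s.1.length ≤ 1 :=
  (summable_weight hS).tsum_le_of_sum_le (sum_subtype_weight_le_one hS)

theorem card_extensions_le [DecidableEq α] (s : List α) (N : ℕ) :
    (Finset.univ.filter fun w : List.Vector α N => s <+: w.toList).card ≤
      Fintype.card α ^ (N - s.length) := by
  rw [← card_vector]
  refine Finset.card_le_card_of_injOn (List.Vector.drop s.length) (by simp) fun v hv w hw h => ?_
  simp only [Finset.coe_filter, Finset.mem_univ, true_and, Set.mem_ofPred_eq] at hv hw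
  have hdrop : v.toList.drop s.length = w.toList.drop s.length := congrArg List.Vector.toList h
  refine List.Vector.toList_injective ?_
  rw [← List.prefix_iff_eq_append.1 hv, ← List.prefix_iff_eq_append.1 hw, hdrop]

theorem one_le_sum_weight [Nonempty α] {S : Finset (List α)} {N : ℕ}
    (hN : ∀ s ∈ S, s.length ≤ N)
    (hcover : ∀ w : List α, w.length = N → ∃ s ∈ S, s <+: w) :
    1 ≤ ∑ s ∈ S, (1 / Fintype.card α : ℝ) ^ s.length := by
  classical
  have hq : (Fintype.card α : ℝ) ≠ 0 := by exact_mod_cast Fintype.card_ne_zero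
  have hcard : Fintype.card α ^ N ≤ ∑ s ∈ S, Fintype.card α ^ (N - s.length) := by
    rw [← card_vector, ← Finset.card_univ]
    calc (Finset.univ : Finset (List.Vector α N)).card
        ≤ (S.biUnion fun s => Finset.univ.filter fun w : List.Vector α N => s <+: w.toList).card :=
          Finset.card_le_card fun w _ => by simpa using hcover w.toList w.toList_length
      _ ≤ ∑ s ∈ S, (Finset.univ.filter fun w : List.Vector α N => s <+: w.toList).card :=
          Finset.card_biUnion_le
      _ ≤ ∑ s ∈ S, Fintype.card α ^ (N - s.length) :=
          Finset.sum_le_sum fun s _ => card_extensions_le s N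
  refine le_of_mul_le_mul_left (a := (Fintype.card α : ℝ) ^ N) ?_ (by positivity)
  calc (Fintype.card α : ℝ) ^ N * 1 ≤ ∑ s ∈ S, (Fintype.card α : ℝ) ^ (N - s.length) := by
        exact_mod_cast (mul_one _).trans_le hcard
    _ = (Fintype.card α : ℝ) ^ N * ∑ s ∈ S, (1 / Fintype.card α : ℝ) ^ s.length := by
        rw [Finset.mul_sum]
        refine Finset.sum_congr rfl fun s hs => ?_
        rw [pow_sub₀ _ hq (hN s hs), one_div, inv_pow]

theorem tsum_weight_levelCompletion [Nonempty α] {S : Set (List α)}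
    (hS : IsAntichain (· <+: ·) S) {N : ℕ} (hN : ∀ s ∈ S, s.length ≤ N) :
    ∑' s : levelCompletion S N, (1 / Fintype.card α : ℝ) ^ s.1.length = 1 := by
  have hlen : ∀ s ∈ levelCompletion S N, s.length ≤ N := fun s hs =>
    hs.elim (hN s) fun h => h.1.le
  obtain ⟨T, hT⟩ := ((List.finite_length_le α N).subset hlen).exists_finset_coe
  refine le_antisymm (tsum_weight_le_one (isAntichain_levelCompletion hS hN)) ?_
  rw [← hT, Finset.tsum_subtype' T fun s : List α => (1 / Fintype.card α : ℝ) ^ s.length]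
  simp only [← hT, Finset.mem_coe] at hlen
  refine one_le_sum_weight hlen fun w hw => ?_
  simp only [← Finset.mem_coe, hT]
  by_cases h : ∃ d ∈ S, d <+: w
  · exact h.imp fun d hd => ⟨.inl hd.1, hd.2⟩
  · exact ⟨w, .inr ⟨hw, fun d hd hdw => h ⟨d, hd, hdw⟩⟩, List.prefix_rfl⟩

end Weights

/-! ## Bit strings -/

/-- The inverse of `strNum`. -/
def strOf : ℕ → List Bool
  | 0 => []
  | n + 1 => strOf (n / 2) ++ [decide (n % 2 = 1)]

theorem strNum_concat (s : List Bool) (b : Bool) :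
    strNum (s ++ [b]) = 2 * strNum s + 1 + b.toNat := by
  simp [strNum]

@[simp] theorem strNum_strOf (n : ℕ) : strNum (strOf n) = n := by
  induction n using Nat.strong_induction_on with
  | _ n ih =>
    cases n with
    | zero => simp [strOf, strNum]
    | succ n =>
      rw [strOf, strNum_concat, ih _ (by omega)]
      rcases Nat.mod_two_eq_zero_or_one n with h | h <;>
        simp only [h, zero_ne_one, decide_false, decide_true, Bool.toNat_false,
          Bool.toNat_true] <;>
        omega

@[simp] theorem strOf_strNum (s : List Bool) : strOf (strNum s) = s := by
  induction s using List.reverseRecOn with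
  | nil => simp [strOf, strNum]
  | append_singleton s b ih =>
    have hdiv : (2 * strNum s + b.toNat) / 2 = strNum s := by
      have := b.toNat_le
      omega
    rw [strNum_concat, Nat.add_right_comm, strOf, hdiv, ih]
    cases b <;> simp

theorem strOf_injective : Function.Injective strOf :=
  Function.LeftInverse.injective strNum_strOf

theorem length_le_strNum (s : List Bool) : s.length ≤ strNum s := by
  induction s using List.reverseRecOn with
  | nil => simp
  | append_singleton s b ih =>
    rw [strNum_concat, List.length_append, List.length_singleton]
    omega

theorem primrec_strNum : Primrec strNum :=
  Primrec.list_foldl (h := fun _ (z : ℕ × Bool) => 2 * z.1 + 1 + z.2.toNat) Primrec.id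
    (Primrec.const 0)
    (Primrec.nat_add.comp (Primrec.nat_double_succ.comp (Primrec.fst.comp Primrec.snd))
      ((Primrec.dom_bool _).comp (Primrec.snd.comp Primrec.snd)))

theorem primrec_strOf : Primrec strOf := by
  have hpred : Primrec fun p : Unit × List (List Bool) => p.2.length - 1 :=
    Primrec.nat_sub.comp (Primrec.list_length.comp Primrec.snd) (Primrec.const 1)
  have hbit : Primrec fun p : Unit × List (List Bool) => decide ((p.2.length - 1) % 2 = 1) :=
    (Primrec.eq.comp (Primrec.nat_mod.comp hpred (Primrec.const 2)) (Primrec.const 1)).decide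
  have hrec : Primrec₂ fun (_ : Unit) (l : List (List Bool)) =>
      if l.length = 0 then some [] else
        some (l.getD ((l.length - 1) / 2) [] ++ [decide ((l.length - 1) % 2 = 1)]) :=
    Primrec.ite (Primrec.eq.comp (Primrec.list_length.comp Primrec.snd) (Primrec.const 0))
      (Primrec.const _)
      (Primrec.option_some.comp (Primrec.list_append.comp
        ((Primrec.list_getD []).comp Primrec.snd (Primrec.nat_div.comp hpred (Primrec.const 2)))
        (Primrec.list_cons.comp hbit (Primrec.const []))))
  refine ((Primrec.nat_strong_rec (fun _ n => strOf n) hrec fun _ n => ?_).comp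
    (Primrec.const ()) Primrec.id)
  cases n with
  | zero => simp [strOf]
  | succ n =>
    have : n / 2 < n + 1 := by omega
    simp [strOf, this]

theorem primrecRel_prefix {α : Type*} [Primcodable α] :
    PrimrecRel fun s t : List α => s <+: t :=
  (Primrec.eq.comp (Primrec.list_take.comp (Primrec.list_length.comp Primrec.fst) Primrec.snd)
    Primrec.fst).of_eq fun _ => eq_comm.trans List.prefix_iff_eq_take.symm

theorem halts_iff_dom {e : ℕ} {s : List Bool} : Halts e s ↔ (prog e (strNum s)).Dom :=
  ⟨fun ⟨_, h⟩ => Part.dom_iff_mem.2 ⟨_, h⟩, fun h =>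
    ⟨strOf ((prog e (strNum s)).get h), by rw [Outputs, strNum_strOf]; exact Part.get_mem h⟩⟩

theorem isMachine_iff_isAntichain {e : ℕ} :
    IsMachine e ↔ IsAntichain (· <+: ·) {s | Halts e s} :=
  ⟨fun h s hs t ht hne hst => hne (h s t hs ht hst), fun h _ _ hs ht hst => h.eq hs ht hst⟩

theorem Omega_eq_tsum_weight (e : ℕ) :
    Omega e = ∑' s : {s | Halts e s}, (1 / Fintype.card Bool : ℝ) ^ s.1.length := by
  rw [Fintype.card_bool]
  rfl

/-! ## Halting probabilities as c.e. reals -/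

theorem tsum_subtype_eq_iSup {β ι : Type*} [SemilatticeSup ι] [Nonempty ι] {S : Set β}
    {f : β → ℝ} (hf₀ : ∀ b, 0 ≤ f b) (hf : Summable fun b : S => f b) {F : ι → Finset β}
    (hF : Monotone F) (hS : ∀ b, b ∈ S ↔ ∃ n, b ∈ F n) :
    ∑' b : S, f b = ⨆ n, ∑ b ∈ F n, f b := by
  classical
  let G : ι → Finset S := fun n => (F n).subtype (· ∈ S)
  have hG : Monotone G := fun m n hmn => Finset.subtype_mono (hF hmn)
  have hsum : ∀ n, ∑ b ∈ F n, f b = ∑ b ∈ G n, f b := fun n =>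
    (Finset.sum_subtype_of_mem f fun b hb => (hS b).2 ⟨n, hb⟩).symm
  have hlim : Filter.Tendsto G Filter.atTop Filter.atTop :=
    Filter.tendsto_atTop_finset_of_monotone hG fun b =>
      ((hS b).1 b.2).imp fun n hn => Finset.mem_subtype.2 hn
  simp only [hsum]
  exact (isLUB_of_tendsto_atTop
    (fun m n hmn => Finset.sum_le_sum_of_subset_of_nonneg (hG hmn) fun b _ _ => hf₀ b)
    (hf.hasSum.comp hlim)).ciSup_eq.symm

/-- The strings on which the program `c` is seen to halt within `n` stages. -/
def stage (c : Code) (n : ℕ) : List (List Bool) :=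
  ((List.range n).filter fun m => (c.evaln n m).isSome).map strOf

theorem mem_stage {c : Code} {n : ℕ} {s : List Bool} :
    s ∈ stage c n ↔ ∃ y, y ∈ c.evaln n (strNum s) := by
  simp only [stage, List.mem_map, List.mem_filter, List.mem_range, Option.isSome_iff_exists]
  constructor
  · rintro ⟨m, ⟨-, h⟩, rfl⟩
    rwa [strNum_strOf]
  · rintro ⟨y, hy⟩
    exact ⟨strNum s, ⟨Code.evaln_bound hy, y, hy⟩, strOf_strNum s⟩

theorem nodup_stage (c : Code) (n : ℕ) : (stage c n).Nodup :=
  (List.nodup_range.filter _).map strOf_injective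

theorem length_lt_of_mem_stage {c : Code} {n : ℕ} {s : List Bool} (h : s ∈ stage c n) :
    s.length < n :=
  let ⟨_, hy⟩ := mem_stage.1 h
  (length_le_strNum s).trans_lt (Code.evaln_bound hy)

theorem stage_mono {c : Code} {m n : ℕ} (h : m ≤ n) : stage c m ⊆ stage c n := fun _ hs =>
  mem_stage.2 ((mem_stage.1 hs).imp fun _ => Code.evaln_mono h)

theorem halts_iff_exists_mem_stage {e : ℕ} {s : List Bool} :
    Halts e s ↔ ∃ n, s ∈ stage (Denumerable.ofNat Code e) n := by
  simp only [halts_iff_dom, Part.dom_iff_mem, prog, Code.evaln_complete, mem_stage]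
  exact exists_comm

theorem primrec₂_stage : Primrec₂ stage := by
  have hhalt : PrimrecRel fun (m : ℕ) (z : Code × ℕ) => (z.1.evaln z.2 m).isSome :=
    Primrec.eq.comp (Primrec.option_isSome.comp (Code.primrec_evaln.comp
      (((Primrec.snd.comp Primrec.snd).pair (Primrec.fst.comp Primrec.snd)).pair Primrec.fst)))
      (Primrec.const true)
  refine (Primrec.list_map (hhalt.listFilter.comp (Primrec.list_range.comp Primrec.snd)
    Primrec.id) (primrec_strOf.comp Primrec.snd).to₂).of_eq fun z => ?_
  simp [stage]

/-- The total weight of `stage c n`, in units of `2⁻ⁿ`. -/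
def stageSum (c : Code) (n : ℕ) : ℕ :=
  ((stage c n).map fun s => 2 ^ (n - s.length)).sum

theorem stageSum_div (c : Code) (n : ℕ) :
    (stageSum c n : ℝ) / 2 ^ n =
      ∑ s ∈ (stage c n).toFinset, (1 / Fintype.card Bool : ℝ) ^ s.length := by
  rw [stageSum, ← List.sum_toFinset _ (nodup_stage c n), Nat.cast_sum, Finset.sum_div]
  refine Finset.sum_congr rfl fun s hs => ?_
  have hs' : s.length ≤ n := (length_lt_of_mem_stage (List.mem_toFinset.1 hs)).le
  rw [div_eq_iff (by positivity), Fintype.card_bool, Nat.cast_pow, Nat.cast_ofNat,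
    pow_sub₀ _ two_ne_zero hs', one_div, inv_pow, mul_comm]

theorem primrec_two_pow : Primrec fun n : ℕ => 2 ^ n :=
  (Primrec₂.unpaired'.1 Nat.Primrec.pow).comp (Primrec.const 2) Primrec.id

theorem primrec₂_stageSum : Primrec₂ stageSum := by
  have hsum : Primrec fun l : List ℕ => l.sum :=
    Primrec.list_foldr (h := fun _ z => z.1 + z.2) Primrec.id (Primrec.const 0)
      (Primrec.nat_add.comp (Primrec.fst.comp Primrec.snd) (Primrec.snd.comp Primrec.snd))
  exact hsum.comp (Primrec.list_map primrec₂_stage (primrec_two_pow.comp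
    (Primrec.nat_sub.comp (Primrec.snd.comp Primrec.fst)
      (Primrec.list_length.comp Primrec.snd))).to₂)

theorem ceReal_eq_iSup {e : ℕ} {a b : ℕ → ℕ} (h : ∀ n, prog e n = Part.some (Nat.pair (a n) (b n)))
    (hab : ∀ n, a n ≤ b n + 1) : ceReal e = ⨆ n, (a n : ℝ) / (b n + 1) := by
  have hset : {x : ℝ | ∃ a b, Lists e a b ∧ x = a / (b + 1)} =
      Set.range fun n => (a n : ℝ) / (b n + 1) := by
    ext x
    constructor
    · rintro ⟨a', b', ⟨-, n, hn⟩, rfl⟩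
      rw [h, Part.mem_some_iff, Nat.pair_eq_pair] at hn
      obtain ⟨rfl, rfl⟩ := hn
      exact ⟨n, rfl⟩
    · rintro ⟨n, rfl⟩
      exact ⟨a n, b n, ⟨hab n, n, by rw [h]; exact Part.mem_some _⟩, rfl⟩
  rw [ceReal, hset, iSup]

theorem Omega_eq_iSup {e : ℕ} (he : IsMachine e) :
    Omega e = ⨆ n, (stageSum (Denumerable.ofNat Code e) n : ℝ) / 2 ^ n := by
  have hsum := summable_weight (isMachine_iff_isAntichain.1 he)
  have hmono : Monotone fun n => (stage (Denumerable.ofNat Code e) n).toFinset :=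
    fun m n hmn s hs => List.mem_toFinset.2 (stage_mono hmn (List.mem_toFinset.1 hs))
  have hstage : ∀ s, s ∈ {s | Halts e s} ↔
      ∃ n, s ∈ (stage (Denumerable.ofNat Code e) n).toFinset := fun s => by
    simpa only [List.mem_toFinset, Set.mem_ofPred_eq] using halts_iff_exists_mem_stage
  rw [Omega_eq_tsum_weight, tsum_subtype_eq_iSup
    (f := fun s : List Bool => (1 / Fintype.card Bool : ℝ) ^ s.length)
    (fun s => by positivity) hsum hmono hstage]
  simp only [stageSum_div]

theorem stageSum_le {e : ℕ} (he : IsMachine e) (n : ℕ) :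
    stageSum (Denumerable.ofNat Code e) n ≤ 2 ^ n := by
  have hle : (stageSum (Denumerable.ofNat Code e) n : ℝ) / 2 ^ n ≤ 1 := by
    rw [stageSum_div]
    exact sum_weight_le_one ((isMachine_iff_isAntichain.1 he).subset fun s hs =>
      halts_iff_exists_mem_stage.2 ⟨n, List.mem_toFinset.1 hs⟩)
  rw [div_le_one (by positivity)] at hle
  exact_mod_cast hle

theorem exists_representsOmega : ∃ r : ℕ → ℕ, RepresentsOmega r := by
  have hF : Primrec fun z : ℕ => Nat.pair (stageSum (Denumerable.ofNat Code z.unpair.1) z.unpair.2)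
      (2 ^ z.unpair.2 - 1) := by
    have h₂ : Primrec fun z : ℕ => z.unpair.2 := Primrec.snd.comp Primrec.unpair
    exact Primrec₂.natPair.comp
      (primrec₂_stageSum.comp ((Primrec.ofNat Code).comp (Primrec.fst.comp Primrec.unpair)) h₂)
      (Primrec.nat_sub.comp (primrec_two_pow.comp h₂) (Primrec.const 1))
  obtain ⟨c, hc⟩ := Code.exists_code.1 (Partrec.nat_iff.1 hF.to_comp.partrec)
  refine ⟨fun e => Encodable.encode (c.curry e), ?_, fun e he => ?_⟩
  · exact (Primrec.encode.comp (Code.primrec₂_curry.comp (Primrec.const c) Primrec.id)).to_comp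
  have hprog : ∀ n, prog (Encodable.encode (c.curry e)) n =
      Part.some (Nat.pair (stageSum (Denumerable.ofNat Code e) n) (2 ^ n - 1)) := fun n => by
    rw [prog, Denumerable.ofNat_encode, Code.eval_curry, hc]
    simp
  have hpow : ∀ n : ℕ, 2 ^ n - 1 + 1 = 2 ^ n := fun n => Nat.sub_add_cancel Nat.one_le_two_pow
  rw [ceReal_eq_iSup hprog fun n => (stageSum_le he n).trans_eq (hpow n).symm, Omega_eq_iSup he]
  refine iSup_congr fun n => ?_
  congr 1
  exact_mod_cast hpow n

/-! ## A universal prefix-free machine -/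

/-- Within `k` stages, the program `c` is seen to halt on a string other than `s` that is
comparable to `s`. -/
abbrev Conflict (c : Code) (k : ℕ) (s : List Bool) : Prop :=
  ∃ d ∈ stage c k, d ≠ s ∧ (d <+: s ∨ s <+: d)

theorem primrecPred_conflict :
    PrimrecPred fun z : (Code × List Bool) × ℕ => Conflict z.1.1 z.2 z.1.2 := by
  have hcomparable : PrimrecRel fun d s : List Bool => d ≠ s ∧ (d <+: s ∨ s <+: d) :=
    Primrec.eq.not.and (primrecRel_prefix.or (primrecRel_prefix.comp Primrec.snd Primrec.fst))
  exact hcomparable.exists_mem_list.comp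
    (primrec₂_stage.comp (Primrec.fst.comp Primrec.fst) Primrec.snd)
    (Primrec.snd.comp Primrec.fst)

theorem not_conflict_of_isMachine {e : ℕ} (he : IsMachine e) {s : List Bool} (hs : Halts e s)
    (k : ℕ) : ¬ Conflict (Denumerable.ofNat Code e) k s := by
  rintro ⟨d, hd, hne, hcomp⟩
  have hd' : Halts e d := halts_iff_exists_mem_stage.2 ⟨k, hd⟩
  exact hne (hcomp.elim (he d s hd' hs) fun h => (he s d hs hd' h).symm)

/-- The program `c` on input `s`, made to diverge if a conflict is seen before it halts. This turns
every program into a prefix-free machine. -/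
def prefixFreeRun (c : Code) (s : List Bool) : Part ℕ :=
  Nat.rfindOpt fun k => if Conflict c k s then none else c.evaln k (strNum s)

theorem partrec₂_prefixFreeRun : Partrec₂ prefixFreeRun := by
  have hev : Primrec fun w : (Code × List Bool) × ℕ => w.1.1.evaln w.2 (strNum w.1.2) :=
    Code.primrec_evaln.comp ((Primrec.snd.pair (Primrec.fst.comp Primrec.fst)).pair
      (primrec_strNum.comp (Primrec.snd.comp Primrec.fst)))
  exact Partrec.rfindOpt (Primrec.ite primrecPred_conflict (Primrec.const none) hev).to_comp.to₂

theorem isAntichain_dom_prefixFreeRun (c : Code) :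
    IsAntichain (· <+: ·) {s | (prefixFreeRun c s).Dom} := by
  have hrun : ∀ {s}, (prefixFreeRun c s).Dom → ∃ k, ¬ Conflict c k s ∧ s ∈ stage c k :=
    fun {s} hs => by
      obtain ⟨k, y, hy⟩ := Nat.rfindOpt_dom.1 hs
      split_ifs at hy with hk
      · exact absurd hy (Option.not_mem_none y)
      · exact ⟨k, hk, mem_stage.2 ⟨y, hy⟩⟩
  intro s hs t ht hne hst
  obtain ⟨k, hks, hk⟩ := hrun hs
  obtain ⟨l, hlt, hl⟩ := hrun ht
  rcases le_total k l with h | h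
  · exact hlt ⟨s, stage_mono h hk, hne, .inl hst⟩
  · exact hks ⟨t, stage_mono h hl, hne.symm, .inr hst⟩

theorem prefixFreeRun_eq_prog {e : ℕ} (he : IsMachine e) {s : List Bool} (hs : Halts e s) :
    prefixFreeRun (Denumerable.ofNat Code e) s = prog e (strNum s) := by
  simp only [prefixFreeRun, if_neg (not_conflict_of_isMachine he hs _), prog,
    Code.eval_eq_rfindOpt]

/-- The universal machine: on input `0 ^ i 1 t`, run the prefix-free version of program `i`
on `t`. -/
def universalRun (s : List Bool) : Part ℕ :=
  if true ∈ s then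
    prefixFreeRun (Denumerable.ofNat Code (s.idxOf true)) (s.drop (s.idxOf true + 1))
  else Part.none

theorem partrec_universalRun : Partrec universalRun := by
  have hmem : PrimrecPred fun s : List Bool => true ∈ s :=
    (Primrec.eq.comp Primrec.id (Primrec.const true)).exists_mem_list.of_eq fun s => by simp
  have hidx : Primrec fun s : List Bool => s.idxOf true :=
    Primrec.list_idxOf.comp (Primrec.const true) Primrec.id
  refine (Partrec.cond hmem.decide.to_comp (partrec₂_prefixFreeRun.comp
    ((Primrec.ofNat Code).comp hidx).to_comp
    (Primrec.list_drop.comp (Primrec.succ.comp hidx) Primrec.id).to_comp) Partrec.none).of_eq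
    fun s => ?_
  by_cases hs : true ∈ s <;> simp [universalRun, hs]

theorem isAntichain_dom_universalRun :
    IsAntichain (· <+: ·) {s | (universalRun s).Dom} := by
  have htrue : ∀ {s}, (universalRun s).Dom → true ∈ s := fun {s} hs => by
    by_contra h
    rw [universalRun, if_neg h] at hs
    exact hs
  intro s hs t ht hne hst
  have hsmem := htrue hs
  have hidx := hst.idxOf_eq_of_mem hsmem
  simp only [Set.mem_ofPred_eq, universalRun, if_pos hsmem, if_pos (htrue ht), ← hidx] at hs ht
  have hdrop := (isAntichain_dom_prefixFreeRun _).eq hs ht (hst.drop _)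
  have hlen := congrArg List.length hdrop
  have hlt := List.idxOf_lt_length_iff.2 hsmem
  have hle := hst.length_le
  rw [List.length_drop, List.length_drop] at hlen
  exact hne (hst.eq_of_length (by omega))

theorem universalRun_replicate (i : ℕ) (t : List Bool) :
    universalRun (List.replicate i false ++ true :: t) =
      prefixFreeRun (Denumerable.ofNat Code i) t := by
  have hidx : (List.replicate i false ++ true :: t).idxOf true = i := by
    rw [List.idxOf_append_of_notMem (by simp), List.idxOf_cons_self, List.length_replicate,
      add_zero]
  rw [universalRun, if_pos (by simp), hidx, List.drop_append]
  simp

theorem isUniversal_of_prog_eq {u : ℕ} (h : ∀ s, prog u (strNum s) = universalRun s) :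
    IsUniversal u := by
  constructor
  · rw [isMachine_iff_isAntichain]
    simp only [halts_iff_dom, h]
    exact isAntichain_dom_universalRun
  · refine fun e he => ⟨e + 1, fun s t hst => ⟨List.replicate e false ++ true :: s, ?_, ?_⟩⟩
    · rwa [Outputs, h, universalRun_replicate, prefixFreeRun_eq_prog he ⟨t, hst⟩]
    · rw [List.length_append, List.length_replicate, List.length_cons]
      omega

theorem exists_code_universalRun : ∃ c : Code, ∀ s, c.eval (strNum s) = universalRun s := by
  obtain ⟨c, hc⟩ := Code.exists_code.1
    (Partrec.nat_iff.1 (partrec_universalRun.comp primrec_strOf.to_comp))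
  exact ⟨c, fun s => by simp only [hc, strOf_strNum]⟩

/-! ## Spoiling an enumerated machine -/

/-- The string `s` has length `k`, and no prefix on which `c` is seen to halt within `k` stages. -/
abbrev Fills (c : Code) (k : ℕ) (s : List Bool) : Prop :=
  s.length = k ∧ ∀ d ∈ stage c k, ¬ d <+: s

/-- Run the program `c` until `f` enumerates `ρ`, say at stage `k`; from then on, halt only on the
strings of length `k` that complete the strings found so far to a maximal prefix-free set. -/
def spoiledRun (c : Code) (f : ℕ → Option ℕ) (ρ : ℕ) (s : List Bool) : Part ℕ :=
  Nat.rfindOpt fun k =>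
    if ∃ j < k, f j = some ρ then none
    else c.evaln k (strNum s) <|> if f k = some ρ ∧ Fills c k s then some 0 else none

theorem partrec₂_spoiledRun (c : Code) {f : ℕ → Option ℕ} (hf : Primrec f) :
    Partrec₂ (spoiledRun c f) := by
  have hρ : Primrec fun w : (ℕ × List Bool) × ℕ => w.1.1 := Primrec.fst.comp Primrec.fst
  have hs : Primrec fun w : (ℕ × List Bool) × ℕ => w.1.2 := Primrec.snd.comp Primrec.fst
  have hev : Primrec fun w : (ℕ × List Bool) × ℕ => c.evaln w.2 (strNum w.1.2) :=
    Code.primrec_evaln.comp ((Primrec.snd.pair (Primrec.const c)).pair (primrec_strNum.comp hs))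
  have henum : PrimrecRel fun j ρ : ℕ => f j = some ρ :=
    Primrec.eq.comp (hf.comp Primrec.fst) (Primrec.option_some.comp Primrec.snd)
  have hfills : PrimrecPred fun w : (ℕ × List Bool) × ℕ => Fills c w.2 w.1.2 :=
    (Primrec.eq.comp (Primrec.list_length.comp hs) Primrec.snd).and
      (primrecRel_prefix.not.forall_mem_list.comp
        (primrec₂_stage.comp (Primrec.const c) Primrec.snd) hs)
  exact Partrec.rfindOpt (Primrec.ite (henum.exists_lt.comp Primrec.snd hρ) (Primrec.const none)
    (Primrec.option_orElse.comp hev (Primrec.ite ((henum.comp Primrec.snd hρ).and hfills)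
      (Primrec.const (some 0)) (Primrec.const none)))).to_comp.to₂

theorem spoiledRun_eq_eval (c : Code) {f : ℕ → Option ℕ} {ρ : ℕ} (h : ∀ k, f k ≠ some ρ)
    (s : List Bool) : spoiledRun c f ρ s = c.eval (strNum s) := by
  simp [spoiledRun, h, Code.eval_eq_rfindOpt]

theorem dom_spoiledRun_iff (c : Code) {f : ℕ → Option ℕ} {ρ k : ℕ} (hk : f k = some ρ)
    (hmin : ∀ j < k, f j ≠ some ρ) (s : List Bool) :
    (spoiledRun c f ρ s).Dom ↔ s ∈ levelCompletion {s | s ∈ stage c k} k := by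
  have hearly : ∀ l, (∃ j < l, f j = some ρ) ↔ k < l := fun l =>
    ⟨fun ⟨j, hj, hfj⟩ => (not_lt.1 fun h => hmin j h hfj).trans_lt hj, fun h => ⟨k, h, hk⟩⟩
  simp only [spoiledRun, Nat.rfindOpt_dom, hearly]
  constructor
  · rintro ⟨l, y, hy⟩
    split_ifs at hy with hkl hl
    · exact absurd hy (Option.not_mem_none y)
    · obtain rfl : l = k := (not_lt.1 hkl).eq_of_not_lt fun h => hmin l h hl.1
      exact .inr hl.2
    · exact .inl (stage_mono (not_lt.1 hkl) (mem_stage.2 ⟨y, by simpa using hy⟩))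
  · intro hs
    rcases heval : c.evaln k (strNum s) with - | y
    · have hfills : Fills c k s := hs.resolve_left fun h => by
        simpa [heval] using mem_stage.1 h
      exact ⟨k, 0, by simpa [heval, hk, hfills.1] using hfills.2⟩
    · exact ⟨k, y, by simp [heval]⟩

theorem isMachine_and_Omega_eq_one_of_spoiledRun {c : Code}
    (hc : IsAntichain (· <+: ·) {s | (c.eval (strNum s)).Dom}) {f : ℕ → Option ℕ} {ρ k : ℕ}
    (hk : f k = some ρ) {t : ℕ} (ht : ∀ s, prog t (strNum s) = spoiledRun c f ρ s) :
    IsMachine t ∧ Omega t = 1 := by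
  classical
  have hex : ∃ k, f k = some ρ := ⟨k, hk⟩
  have hdom : {s | Halts t s} =
      levelCompletion {s | s ∈ stage c (Nat.find hex)} (Nat.find hex) := by
    ext s
    rw [← dom_spoiledRun_iff c (Nat.find_spec hex) fun j => Nat.find_min hex, ← ht,
      ← halts_iff_dom]
    rfl
  have hstage : IsAntichain (· <+: ·) {s | s ∈ stage c (Nat.find hex)} := hc.subset fun s hs => by
    obtain ⟨y, hy⟩ := mem_stage.1 hs
    exact Part.dom_iff_mem.2 ⟨y, Code.evaln_sound hy⟩
  have hlen : ∀ s ∈ {s | s ∈ stage c (Nat.find hex)}, s.length ≤ Nat.find hex := fun s hs =>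
    (length_lt_of_mem_stage hs).le
  rw [isMachine_iff_isAntichain, Omega_eq_tsum_weight, hdom]
  exact ⟨isAntichain_levelCompletion hstage hlen, tsum_weight_levelCompletion hstage hlen⟩

theorem exists_prog_eq_spoiledRun (c : Code) {f : ℕ → Option ℕ} (hf : Primrec f) {r : ℕ → ℕ}
    (hr : Computable r) : ∃ t, ∀ s, prog t (strNum s) = spoiledRun c f (r t) s := by
  obtain ⟨d, hd⟩ := Code.fixed_point₂
    (f := fun d m => spoiledRun c f (r (Encodable.encode d)) (strOf m))
    ((partrec₂_spoiledRun c hf).comp (hr.comp (Computable.encode.comp Computable.fst))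
      (primrec_strOf.to_comp.comp Computable.snd))
  exact ⟨Encodable.encode d, fun s => by
    simp only [prog, Denumerable.ofNat_encode, hd, strOf_strNum]⟩

theorem exists_universal_not_enumerated {f : ℕ → Option ℕ} (hf : Primrec f)
    (hone : ∀ i e, f i = some e → ceReal e ≠ 1) {r : ℕ → ℕ} (hr : RepresentsOmega r) :
    ∃ t, IsUniversal t ∧ ∀ i, f i ≠ some (r t) := by
  obtain ⟨c, hc⟩ := exists_code_universalRun
  obtain ⟨t, ht⟩ := exists_prog_eq_spoiledRun c hf hr.1
  have hdom : IsAntichain (· <+: ·) {s | (c.eval (strNum s)).Dom} := by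
    simpa only [hc] using isAntichain_dom_universalRun
  have hnot : ∀ i, f i ≠ some (r t) := fun i hi => by
    obtain ⟨hM, hΩ⟩ := isMachine_and_Omega_eq_one_of_spoiledRun hdom hi ht
    exact hone i _ hi ((hr.2 t hM).trans hΩ)
  exact ⟨t, isUniversal_of_prog_eq fun s => by rw [ht, spoiledRun_eq_eval c hnot, hc], hnot⟩

end ProvRand

theorem mainTheorem10 :
    ∃ f : ℕ → Option ℕ, Primrec f ∧
      (∀ e, (∃ i, f i = some e) ↔ ProvRand.ProvablyRandom e) ∧
      (∃ r : ℕ → ℕ, ProvRand.RepresentsOmega r) ∧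
      ∀ r : ℕ → ℕ, ProvRand.RepresentsOmega r →
        ∃ t : ℕ, ProvRand.IsUniversal t ∧ (∀ i, f i ≠ some (r t)) ∧
          ¬ ProvRand.ProvablyRandom (r t) := by
  obtain ⟨f, hf, hspec⟩ := ProvRand.exists_primrec_enum_provablyRandom
  refine ⟨f, hf, hspec, ProvRand.exists_representsOmega, fun r hr => ?_⟩
  have hone : ∀ i e, f i = some e → ProvRand.ceReal e ≠ 1 := fun i e hi h =>
    ProvRand.not_provablyRandom_of_one_le_ceReal h.ge ((hspec e).1 ⟨i, hi⟩)
  obtain ⟨t, huniv, ht⟩ := ProvRand.exists_universal_not_enumerated hf hone hr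
  exact ⟨t, huniv, ht, fun h => ((hspec (r t)).2 h).elim ht⟩
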